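/- **Notation.** Let $d\ge 1$. For $\mathbf n\in\mathbb N_0^d$ and $\mathbf x\in\mathbb C^d$ put $|\mathbf n|=\sum_i n_i$, $|\mathbf x|=\sum_i x_i$, $\mathbf n!=\prod_i n_i!$, $\mathbf x^{\pm\mathbf n}=\prod_i x_i^{\pm n_i}$, $\|\mathbf x\|^2=\sum_i|x_i|^2$, and let $(\beta)_k=\beta(\beta+1)\cdots(\beta+k-1)$. For $\beta\in\mathbb C\setminus(-\mathbb N_0)$, a complex $d\times d$ matrix $U$ and $\mathbf x\in\mathbb C^d$, the multivariate Meixner polynomials $M_{\mathbf n}(\mathbf x;U,\beta)$, $\mathbf n\in\mathbb N_0^d$, are defined by $$\Big(1-\sum_{j=1}^d t_j\Big)^{-\beta-|\mathbf x|}\prod_{i=1}^d\Big(1-\sum_{j=1}^dU_{i,j}t_j\Big)^{x_i}=\sum_{\mathbf n\in\mathbb N_0^d}\frac{(\beta)_{|\mathbf n|}}{\mathbf n!}M_{\mathbf n}(\mathbf x;U,\beta)\,\mathbf t^{\mathbf n}$$ for $\mathbf t\in\mathbb C^d$ sufficiently close to $0$ (principal branches of the powers). Let $\mathrm{SU}(1,d)$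 be the group of complex $(d+1)\times(d+1)$ matrices $g$ with $\det g=1$ and $g^\dagger Jg=J$, where $J=\mathrm{diag}(1,-1,\dots,-1)$. Write $g=\begin{pmatrix}a&\mathbf b^t\\ \mathbf c&D\end{pmatrix}$ with $a\in\mathbb C$, $\mathbf b,\mathbf c\in\mathbb C^d$ and $D$ a $d\times d$ matrix, and call $g$ *generic* if $a,b_i,c_i\ne0$ for all $i$. For generic $g$ put $$p_i=\frac{b_i}{a},\qquad \tilde p_i=\frac{c_i}{a},\qquad U_{i,j}=\frac{aD_{j,i}}{b_ic_j},\qquad |p_0|^2=|a|^{-2}.$$ Let $\mathbb B_d=\{\mathbf z\in\mathbb C^d:\|\mathbf z\|<1\}$, and let $dv$ be the volume measure on $\mathbb B_d$ normalized so that $v(\mathbb B_d)=1$. **Theorem.** Let $\sigma\ge d+1$ be an integer, let $g\in\mathrm{SU}(1,d)$ be generic and let $\mathbf p,\tilde{\mathbf p},U$ be as above. (i) For all $\mathbf m,\mathbf m',\mathbf n,\mathbf n'\in\mathbb N_0^d$ (with unconditionally convergent sums) $$\sum_{\mathbf n\in\mathbb N_0^d}\frac{(\sigma)_{|\mathbf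 n|}}{\mathbf n!}\mathbf p^{\mathbf n}\overline{\mathbf p}^{\mathbf n}M_{\mathbf m}(\mathbf n;U,\sigma)\overline{M_{\mathbf m'}(\mathbf n;U,\sigma)}=\delta_{\mathbf m,\mathbf m'}\frac{\mathbf m!\,\tilde{\mathbf p}^{-\mathbf m}\overline{\tilde{\mathbf p}}^{-\mathbf m}}{(\sigma)_{|\mathbf m|}|p_0|^{2\sigma}},$$ $$\sum_{\mathbf m\in\mathbb N_0^d}\frac{(\sigma)_{|\mathbf m|}}{\mathbf m!}\tilde{\mathbf p}^{\mathbf m}\overline{\tilde{\mathbf p}}^{\mathbf m}M_{\mathbf m}(\mathbf n;U,\sigma)\overline{M_{\mathbf m}(\mathbf n';U,\sigma)}=\delta_{\mathbf n,\mathbf n'}\frac{\mathbf n!\,\mathbf p^{-\mathbf n}\overline{\mathbf p}^{-\mathbf n}}{(\sigma)_{|\mathbf n|}|p_0|^{2\sigma}}.$$ (ii) For all $\mathbf m,\mathbf n\in\mathbb N_0^d$ the integrand below is integrable and $$(-1)^{|\mathbf m|}\tilde{\mathbf p}^{\mathbf m}M_{\mathbf m}(\mathbf n;U,\sigma)=\frac{(\sigma-d)_d}{d!}\int_{\mathbb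 B_d}\Big(1+\sum_{i=1}^d\tilde p_iz_i\Big)^{-\sigma-|\mathbf n|}\prod_{i=1}^d\Big(1+\sum_{j=1}^dU_{i,j}\tilde p_jz_j\Big)^{n_i}\,\overline{\mathbf z}^{\mathbf m}(1-\|\mathbf z\|^2)^{\sigma-d-1}\,dv.$$ (iii) For all $\mathbf m,\mathbf n\in\mathbb N_0^d$, $M_{\mathbf m}(\mathbf n;U,\sigma)=M_{\mathbf n}(\mathbf m;U^t,\sigma)$. (iv) If $g_1,g_2\in\mathrm{SU}(1,d)$ are such that $g_1,g_2,g_1g_2$ are all generic, then for all $\mathbf m,\mathbf n\in\mathbb N_0^d$ (with an unconditionally convergent sum) $$\Big(\frac{a(g_1)a(g_2)}{a(g_1g_2)}\Big)^{\sigma}\tilde{\mathbf p}(g_1g_2)^{\mathbf m}\,\tilde{\mathbf p}(g_1)^{-\mathbf m}\,\mathbf p(g_1g_2)^{\mathbf n}\,\mathbf p(g_2)^{-\mathbf n}M_{\mathbf m}(\mathbf n;U(g_1g_2),\sigma)=\sum_{\mathbf k\in\mathbb N_0^d}(-1)^{|\mathbf k|}\mathbf p(g_1)^{\mathbf k}\tilde{\mathbf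 p}(g_2)^{\mathbf k}\frac{(\sigma)_{|\mathbf k|}}{\mathbf k!}M_{\mathbf m}(\mathbf k;U(g_1),\sigma)M_{\mathbf k}(\mathbf n;U(g_2),\sigma).$$ -/

import Mathlib

open Filter Topology MeasureTheory
open scoped BigOperators ComplexConjugate Matrix

noncomputable section

namespace MeixnerSU

/-! ### Multi-index notation -/

/-- `|n| = n₁ + ⋯ + n_d`. -/
def mdeg {d : ℕ} (n : Fin d → ℕ) : ℕ := ∑ i, n i

/-- `n! = n₁! ⋯ n_d!`. -/
def mfact {d : ℕ} (n : Fin d → ℕ) : ℕ := ∏ i, (n i).factorial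

/-- `x^n = x₁^{n₁} ⋯ x_d^{n_d}`. -/
def mpow {d : ℕ} (x : Fin d → ℂ) (n : Fin d → ℕ) : ℂ := ∏ i, x i ^ n i

/-- The Pochhammer symbol `(β)_k = β (β + 1) ⋯ (β + k - 1)`. -/
def poch (β : ℂ) (k : ℕ) : ℂ := (ascPochhammer ℂ k).eval β

/-! ### Multivariate Meixner polynomials -/

/-- The generating function
`G(x,t,U,β) = (1 - ∑ⱼ tⱼ)^(-β-|x|) ∏ᵢ (1 - ∑ⱼ U_{ij} tⱼ)^(xᵢ)`, with principal branches. -/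
def genFun {d : ℕ} (x t : Fin d → ℂ) (U : Matrix (Fin d) (Fin d) ℂ) (β : ℂ) : ℂ :=
  (1 - ∑ j, t j) ^ (-β - ∑ i, x i) * ∏ i, (1 - ∑ j, U i j * t j) ^ (x i)

/-- `M` is a family of numbers, indexed by multi-indices, for which
`G(x,t,U,β) = ∑ₙ (β)_{|n|} / n! * M n * t^n` for all `t` sufficiently close to `0`. -/
def IsMeixnerFamily {d : ℕ} (x : Fin d → ℂ) (U : Matrix (Fin d) (Fin d) ℂ) (β : ℂ)
    (M : (Fin d → ℕ) → ℂ) : Prop :=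
  ∀ᶠ t in 𝓝 (0 : Fin d → ℂ),
    HasSum (fun n => poch β (mdeg n) / (mfact n : ℂ) * M n * mpow t n) (genFun x t U β)

/-- The multivariate Meixner polynomial `Mₙ(x; U, β)`, defined by its generating function. For
`β ∉ {0, -1, -2, …}` there is exactly one family as in `IsMeixnerFamily`; see
`existsUnique_isMeixnerFamily` and `isMeixnerFamily_meixner` below. -/
def meixner {d : ℕ} (n : Fin d → ℕ) (x : Fin d → ℂ) (U : Matrix (Fin d) (Fin d) ℂ) (β : ℂ) : ℂ :=
  Classical.epsilon (IsMeixnerFamily x U β) n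

/-! Existence and uniqueness of the family of Meixner polynomials. -/

theorem mpow_add {d : ℕ} (t : Fin d → ℂ) (m n : Fin d → ℕ) :
    mpow t (m + n) = mpow t m * mpow t n := by
  simp [mpow, pow_add, Finset.prod_mul_distrib]

/-- `f` is near `0` the sum of a multivariate power series. -/
def HasExpansion {d : ℕ} (f : (Fin d → ℂ) → ℂ) : Prop :=
  ∃ c : (Fin d → ℕ) → ℂ, ∀ᶠ t in 𝓝 (0 : Fin d → ℂ), HasSum (fun n => c n * mpow t n) (f t)

theorem hasSum_regroup {d : ℕ} {ι : Type*} (φ : ι → (Fin d → ℕ)) (w : ι → ℂ) (t : Fin d → ℂ)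
    (s : ℂ) (h : HasSum (fun i => w i * mpow t (φ i)) s) :
    HasSum (fun n => (∑' i : {i // φ i = n}, w i) * mpow t n) s := by
  have h1 := (Equiv.sigmaFiberEquiv φ).hasSum_iff.mpr h
  refine h1.sigma fun n => ?_
  have h2 : Summable fun i : {i // φ i = n} => w i * mpow t (φ i) := h1.summable.sigma_factor n
  have h3 := h2.hasSum
  have h4 : ∀ i : {i // φ i = n}, w i * mpow t (φ i) = w i * mpow t n := fun i => by rw [i.2]
  simp only [h4, tsum_mul_right] at h3
  have h5 : (fun c : {i // φ i = n} => ((fun i => w i * mpow t (φ i)) ∘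
      (Equiv.sigmaFiberEquiv φ)) ⟨n, c⟩) = fun i : {i // φ i = n} => w i * mpow t n := by
    funext i
    exact h4 i
  rw [h5]
  exact h3

theorem HasExpansion.mul {d : ℕ} {f g : (Fin d → ℂ) → ℂ} (hf : HasExpansion f)
    (hg : HasExpansion g) : HasExpansion fun t => f t * g t := by
  obtain ⟨a, ha⟩ := hf
  obtain ⟨b, hb⟩ := hg
  refine ⟨fun n => ∑' i : {i : (Fin d → ℕ) × (Fin d → ℕ) // i.1 + i.2 = n}, a i.1.1 * b i.1.2, ?_⟩
  filter_upwards [ha, hb] with t hat hbt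
  refine hasSum_regroup (fun i : (Fin d → ℕ) × (Fin d → ℕ) => i.1 + i.2)
    (fun i => a i.1 * b i.2) t _ ?_
  have hs : Summable fun i : (Fin d → ℕ) × (Fin d → ℕ) =>
      (a i.1 * mpow t i.1) * (b i.2 * mpow t i.2) :=
    summable_mul_of_summable_norm (f := fun n => a n * mpow t n) (g := fun n => b n * mpow t n)
      hat.summable.norm hbt.summable.norm
  have h := hat.mul hbt hs
  have he : (fun i : (Fin d → ℕ) × (Fin d → ℕ) => a i.1 * b i.2 * mpow t (i.1 + i.2))
      = fun i => (a i.1 * mpow t i.1) * (b i.2 * mpow t i.2) := by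
    funext i
    rw [mpow_add]
    ring
  rw [he]
  exact h

theorem HasExpansion.one {d : ℕ} : HasExpansion fun _ : Fin d → ℂ => (1 : ℂ) := by
  refine ⟨fun n => if n = 0 then 1 else 0, Eventually.of_forall fun t => ?_⟩
  have := hasSum_ite_eq (0 : Fin d → ℕ) (1 : ℂ)
  refine this.congr_fun ?_
  intro n
  by_cases h : n = 0
  · subst h; simp [mpow]
  · simp [h]

theorem HasExpansion.prod {d : ℕ} {ι : Type*} (s : Finset ι) (f : ι → (Fin d → ℂ) → ℂ)
    (h : ∀ i, HasExpansion (f i)) : HasExpansion fun t => ∏ i ∈ s, f i t := by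
  classical
  induction s using Finset.induction_on with
  | empty => simpa using HasExpansion.one
  | insert a s ha ih => simpa [Finset.prod_insert ha] using (h a).mul ih

theorem hasSum_one_add_cpow (s z : ℂ) (hz : ‖z‖ < 1) :
    HasSum (fun k : ℕ => Ring.choose s k * z ^ k) ((1 + z) ^ s) := by
  have h := (Complex.one_add_cpow_hasFPowerSeriesOnBall_zero (a := s)).hasSum (y := z)
    (by rw [← ENNReal.ofReal_one, Metric.eball_ofReal]; simpa using hz)
  simpa [binomialSeries, FormalMultilinearSeries.coeff_ofScalars, mul_comm] using h

theorem HasExpansion.linear_cpow {d : ℕ} (u : Fin d → ℂ) (s : ℂ) :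
    HasExpansion fun t => (1 - ∑ j, u j * t j) ^ s := by
  let φ : (Σ k : ℕ, Fin k → Fin d) → (Fin d → ℕ) :=
    fun p j => (Finset.univ.filter fun i => p.2 i = j).card
  let w : (Σ k : ℕ, Fin k → Fin d) → ℂ :=
    fun p => Ring.choose s p.1 * ∏ i, (-u (p.2 i))
  refine ⟨fun n => ∑' i : {i // φ i = n}, w i, ?_⟩
  have hc : ∀ᶠ t in 𝓝 (0 : Fin d → ℂ), ∑ j, ‖-u j * t j‖ < 1 := by
    have : Continuous fun t : Fin d → ℂ => ∑ j, ‖-u j * t j‖ := by fun_prop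
    refine this.continuousAt.eventually_lt continuousAt_const ?_
    simp
  filter_upwards [hc] with t ht
  refine hasSum_regroup φ w t _ ?_
  have hw : ∀ p, w p * mpow t (φ p) = Ring.choose s p.1 * ∏ i, (-u (p.2 i) * t (p.2 i)) := by
    intro p
    have : mpow t (φ p) = ∏ i, t (p.2 i) := by
      simp only [mpow, φ]
      rw [← Finset.prod_fiberwise' Finset.univ p.2 t]
      simp
    rw [this, Finset.prod_mul_distrib]
    simp only [w]
    ring
  simp only [hw]
  have hpow : ∀ k : ℕ, ∀ a : Fin d → ℂ, ∑ f : Fin k → Fin d, ∏ i, a (f i) = (∑ j, a j) ^ k := by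
    intro k a
    rw [Fintype.sum_pow]
  have hpowr : ∀ k : ℕ, ∀ a : Fin d → ℝ, ∑ f : Fin k → Fin d, ∏ i, a (f i) = (∑ j, a j) ^ k := by
    intro k a
    rw [Fintype.sum_pow]
  have hle : ‖∑ j, -u j * t j‖ < 1 := (norm_sum_le _ _).trans_lt ht
  have hsum := hasSum_one_add_cpow s _ hle
  have e : (1 - ∑ j, u j * t j) = 1 + ∑ j, -u j * t j := by
    simp [sub_eq_add_neg]
  rw [e]
  refine hsum.sigma_of_hasSum (fun k => ?_) ?_
  · rw [← hpow, Finset.mul_sum]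
    exact hasSum_fintype _
  · refine Summable.of_norm ?_
    rw [summable_sigma_of_nonneg (fun _ => norm_nonneg _)]
    refine ⟨fun k => Summable.of_finite, ?_⟩
    have hρ : 0 ≤ ∑ j, ‖-u j * t j‖ := Finset.sum_nonneg fun _ _ => norm_nonneg _
    have h2 := (hasSum_one_add_cpow s ((∑ j, ‖-u j * t j‖ : ℝ) : ℂ)
      (by rw [Complex.norm_real, Real.norm_of_nonneg hρ]; exact ht)).summable.norm
    refine h2.congr fun k => ?_
    rw [tsum_fintype]
    simp only [norm_mul, norm_prod, norm_pow, Complex.norm_real]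
    rw [← Finset.mul_sum]
    simp only [← norm_mul]
    rw [hpowr k fun j => ‖-u j * t j‖, Real.norm_of_nonneg hρ]

theorem eq_zero_of_expansion {d : ℕ} (c : (Fin d → ℕ) → ℂ)
    (h : ∀ᶠ t in 𝓝 (0 : Fin d → ℂ), HasSum (fun n => c n * mpow t n) 0) : c = 0 := by
  classical
  obtain ⟨ε, hε, hball⟩ := Metric.eventually_nhds_iff.mp h
  have hP : ∀ t : Fin d → ℂ, ‖t‖ < ε → ∀ k : ℕ,
      ∑ n ∈ Finset.piAntidiag Finset.univ k, c n * mpow t n = 0 := by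
    intro t ht
    have hs : HasFPowerSeriesAt (0 : ℂ → ℂ) (FormalMultilinearSeries.ofScalars ℂ fun k : ℕ =>
        ∑ n ∈ Finset.piAntidiag Finset.univ k, c n * mpow t n) 0 := by
      rw [hasFPowerSeriesAt_iff]
      filter_upwards [Metric.ball_mem_nhds (0 : ℂ) one_pos] with z hz
      have hz1 : ‖z‖ < 1 := by simpa using hz
      have h1 : HasSum (fun n => c n * mpow (z • t) n) 0 := by
        apply hball
        rw [dist_zero_right, norm_smul]
        calc ‖z‖ * ‖t‖ ≤ 1 * ‖t‖ := by gcongr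
          _ < ε := by simpa using ht
      have h2 := (Equiv.sigmaFiberEquiv (mdeg (d := d))).hasSum_iff.mpr h1
      have h3 := h2.sigma (g := fun k => z ^ k *
          ∑ n ∈ Finset.piAntidiag Finset.univ k, c n * mpow t n) fun k => by
        have hset : ∀ n : Fin d → ℕ, n ∈ Finset.piAntidiag Finset.univ k ↔ mdeg n = k := by
          intro n; simp [mdeg]
        have h4 := Finset.hasSum (Finset.piAntidiag Finset.univ k)
          (fun n => c n * mpow (z • t) n)
        have h5 : ∑ n ∈ Finset.piAntidiag Finset.univ k, c n * mpow (z • t) n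
            = z ^ k * ∑ n ∈ Finset.piAntidiag Finset.univ k, c n * mpow t n := by
          rw [Finset.mul_sum]
          refine Finset.sum_congr rfl fun n hn => ?_
          have : mpow (z • t) n = z ^ k * mpow t n := by
            rw [← (hset n).mp hn]
            simp [mpow, mdeg, mul_pow, Finset.prod_mul_distrib, Finset.prod_pow_eq_pow_sum]
          rw [this]; ring
        rw [h5] at h4
        exact ((Equiv.subtypeEquivRight hset).hasSum_iff
          (f := fun n : {n : Fin d → ℕ // mdeg n = k} => c n * mpow (z • t) n)).mp h4
      simpa [FormalMultilinearSeries.coeff_ofScalars] using h3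
    intro k
    have h6 := congrArg (fun p => FormalMultilinearSeries.coeff p k) hs.eq_zero
    have h0 : (0 : FormalMultilinearSeries ℂ ℂ ℂ).coeff k = 0 := rfl
    simp only [h0, FormalMultilinearSeries.coeff_ofScalars] at h6
    exact h6
  funext n
  let p : MvPolynomial (Fin d) ℂ := ∑ n ∈ Finset.piAntidiag Finset.univ (mdeg n),
    MvPolynomial.monomial (Finsupp.equivFunOnFinite.symm n) (c n)
  have hp : p = 0 := by
    refine MvPolynomial.funext_set (fun _ => Metric.ball (0 : ℂ) ε) (fun _ => ?_) fun t ht => ?_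
    · exact infinite_of_mem_nhds (0 : ℂ) (Metric.ball_mem_nhds _ hε)
    · have htn : ‖t‖ < ε := (pi_norm_lt_iff hε).mpr fun i => by
        simpa using ht i (Set.mem_univ i)
      have := hP t htn (mdeg n)
      simp only [p, map_sum, MvPolynomial.eval_monomial, map_zero]
      rw [← this]
      refine Finset.sum_congr rfl fun m _ => ?_
      rw [Finsupp.prod_fintype _ _ (by simp)]
      simp [mpow]
  have hcoef := congrArg (MvPolynomial.coeff (Finsupp.equivFunOnFinite.symm n)) hp
  simp only [p, MvPolynomial.coeff_sum, MvPolynomial.coeff_monomial, MvPolynomial.coeff_zero,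
    EmbeddingLike.apply_eq_iff_eq] at hcoef
  rw [Finset.sum_ite_eq' (Finset.piAntidiag Finset.univ (mdeg n)) n c] at hcoef
  simpa [mdeg] using hcoef

theorem mfact_ne_zero {d : ℕ} (n : Fin d → ℕ) : (mfact n : ℂ) ≠ 0 := by
  simp [mfact, Finset.prod_eq_zero_iff, Nat.factorial_ne_zero]

theorem poch_ne_zero {β : ℂ} (hβ : ∀ k : ℕ, β ≠ -(k : ℂ)) (k : ℕ) : poch β k ≠ 0 := by
  rw [poch, Ne, ascPochhammer_eval_eq_zero_iff]
  rintro ⟨j, -, hj⟩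
  exact hβ j (by rw [hj, neg_neg])

/-- For `β ∉ {0, -1, -2, …}` the generating function determines the Meixner polynomials. -/
theorem existsUnique_isMeixnerFamily {d : ℕ} (x : Fin d → ℂ) (U : Matrix (Fin d) (Fin d) ℂ)
    {β : ℂ} (hβ : ∀ k : ℕ, β ≠ -(k : ℂ)) : ∃! M, IsMeixnerFamily x U β M := by
  have hq : ∀ n : Fin d → ℕ, poch β (mdeg n) / (mfact n : ℂ) ≠ 0 := fun n =>
    div_ne_zero (poch_ne_zero hβ _) (mfact_ne_zero n)
  have hG : HasExpansion fun t => genFun x t U β := by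
    have h1 := HasExpansion.linear_cpow (fun _ : Fin d => (1 : ℂ)) (-β - ∑ i, x i)
    have h2 := HasExpansion.prod Finset.univ
      (fun i t => (1 - ∑ j, U i j * t j) ^ (x i)) fun i => HasExpansion.linear_cpow (U i) (x i)
    simpa [genFun] using h1.mul h2
  obtain ⟨c, hc⟩ := hG
  refine ⟨fun n => (poch β (mdeg n) / (mfact n : ℂ))⁻¹ * c n, ?_, fun M hM => ?_⟩
  · filter_upwards [hc] with t ht
    simpa only [mul_inv_cancel_left₀ (hq _)] using ht
  · have := eq_zero_of_expansion
      (fun n => poch β (mdeg n) / (mfact n : ℂ) * M n - c n) (by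
        filter_upwards [hc, hM] with t ht hMt
        simpa [sub_mul] using hMt.sub ht)
    funext n
    have hn := sub_eq_zero.mp (congrFun this n)
    simp only [← hn, inv_mul_cancel_left₀ (hq n)]

theorem isMeixnerFamily_meixner {d : ℕ} (x : Fin d → ℂ) (U : Matrix (Fin d) (Fin d) ℂ)
    {β : ℂ} (hβ : ∀ k : ℕ, β ≠ -(k : ℂ)) :
    IsMeixnerFamily x U β fun n => meixner n x U β :=
  Classical.epsilon_spec (existsUnique_isMeixnerFamily x U hβ).exists

/-! ### The group `SU(1,d)` -/

/-- `J = diag(1, -1, …, -1)`. -/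
def J (d : ℕ) : Matrix (Fin (d + 1)) (Fin (d + 1)) ℂ :=
  Matrix.diagonal (Fin.cons 1 fun _ => -1)

/-- `SU(1,d)`: the complex matrices `g` of determinant `1` with `g† J g = J`. -/
def SU (d : ℕ) : Subgroup (Matrix.SpecialLinearGroup (Fin (d + 1)) ℂ) where
  carrier := {g | (g.1)ᴴ * J d * g.1 = J d}
  one_mem' := by simp
  mul_mem' := by
    intro g h hg hh
    simp only [Set.mem_ofPred_eq] at hg hh ⊢
    rw [Matrix.SpecialLinearGroup.coe_mul, Matrix.conjTranspose_mul]
    calc (h.1)ᴴ * (g.1)ᴴ * J d * (g.1 * h.1)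
        = (h.1)ᴴ * ((g.1)ᴴ * J d * g.1) * h.1 := by simp only [Matrix.mul_assoc]
      _ = J d := by rw [hg, hh]
  inv_mem' := by
    intro g hg
    simp only [Set.mem_ofPred_eq] at hg ⊢
    have h1 : g.1 * (g⁻¹).1 = 1 := by
      rw [← Matrix.SpecialLinearGroup.coe_mul, mul_inv_cancel, Matrix.SpecialLinearGroup.coe_one]
    have h2 : ((g⁻¹).1)ᴴ * (g.1)ᴴ = 1 := by
      rw [← Matrix.conjTranspose_mul, h1, Matrix.conjTranspose_one]
    calc ((g⁻¹).1)ᴴ * J d * (g⁻¹).1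
        = ((g⁻¹).1)ᴴ * ((g.1)ᴴ * J d * g.1) * (g⁻¹).1 := by rw [hg]
      _ = (((g⁻¹).1)ᴴ * (g.1)ᴴ) * J d * (g.1 * (g⁻¹).1) := by simp only [Matrix.mul_assoc]
      _ = J d := by rw [h1, h2, one_mul, mul_one]

/-! The blocks of `g = (a, bᵗ; c, D)` and the parameters built from them. -/

variable {d : ℕ}

/-- The upper left entry `a(g)`. -/
def a (g : SU d) : ℂ := g.1.1 0 0

/-- The first row without `a`, `b(g)`. -/
def b (g : SU d) : Fin d → ℂ := fun i => g.1.1 0 i.succ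

/-- The first column without `a`, `c(g)`. -/
def c (g : SU d) : Fin d → ℂ := fun i => g.1.1 i.succ 0

/-- The lower right `d × d` block `D(g)`. -/
def D (g : SU d) : Matrix (Fin d) (Fin d) ℂ := Matrix.of fun i j => g.1.1 i.succ j.succ

/-- The non-degeneracy condition `a, bᵢ, cᵢ ≠ 0`. -/
def IsGeneric (g : SU d) : Prop := a g ≠ 0 ∧ ∀ i, b g i ≠ 0 ∧ c g i ≠ 0

/-- `pᵢ = bᵢ / a`. -/
def p (g : SU d) : Fin d → ℂ := fun i => b g i / a g

/-- `p̃ᵢ = cᵢ / a`. -/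
def pt (g : SU d) : Fin d → ℂ := fun i => c g i / a g

/-- `U_{ij} = a D_{ji} / (bᵢ cⱼ)`. -/
def U (g : SU d) : Matrix (Fin d) (Fin d) ℂ :=
  Matrix.of fun i j => a g * D g j i / (b g i * c g j)

/-- `|p₀|² = |a|⁻²`. -/
def p0sq (g : SU d) : ℝ := (‖a g‖ ^ 2)⁻¹

/-- `Mₘ(n; U, σ)` for a multi-index `n` and a positive integer `σ`. -/
def M (σ : ℕ) (V : Matrix (Fin d) (Fin d) ℂ) (m n : Fin d → ℕ) : ℂ :=
  meixner m (fun i => (n i : ℂ)) V (σ : ℂ)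

/-! ### The unit ball -/

/-- The open unit ball of `ℂ^d` for the Euclidean norm. -/
def unitBall (d : ℕ) : Set (Fin d → ℂ) := {z | ∑ i, ‖z i‖ ^ 2 < 1}

/-- The volume measure `dv` on the unit ball, normalized to total mass `1`. -/
def ballMeasure (d : ℕ) : Measure (Fin d → ℂ) :=
  (volume (unitBall d))⁻¹ • (volume : Measure (Fin d → ℂ)).restrict (unitBall d)

/-- The integrand
`(1 + ∑ᵢ p̃ᵢ zᵢ)^(-σ-|n|) ∏ᵢ (1 + ∑ⱼ U_{ij} p̃ⱼ zⱼ)^(nᵢ) * conj(z)^m * (1 - ‖z‖²)^(σ-d-1)`. -/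
def ballIntegrand (σ : ℕ) (g : SU d) (m n : Fin d → ℕ) (z : Fin d → ℂ) : ℂ :=
  (1 + ∑ i, pt g i * z i) ^ (-(σ : ℤ) - (mdeg n : ℤ))
    * (∏ i, (1 + ∑ j, U g i j * pt g j * z j) ^ n i)
    * mpow (fun i => conj (z i)) m
    * ((1 - ∑ i, ‖z i‖ ^ 2 : ℝ) : ℂ) ^ ((σ : ℤ) - (d : ℤ) - 1)

end MeixnerSU

end

/-!
Multivariate Meixner polynomials at multi-indices are matrix coefficients. A matrix `h` of size
`d + 1` acts on functions of `z ∈ ℂ^d` with weight `σ` by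
`(h f)(z) = (a + c·z)^(-σ) f((b + Dᵗ z) / (a + c·z))`, and `matCoeff σ h m n` denotes the
coefficient of `z^m` in the image of `z^n`. For generic `h` the substitution
`t_j = -(c_j / a) z_j` in the generating function (`matCoeff_eq_meixner`) gives
`matCoeff σ h m n = a^(-σ) p^n (σ)_{|m|} / m! (-1)^{|m|} p̃^m M_m(n; U)`.
All assertions are translations of properties of these coefficients.

* The action is a homomorphism, so the coefficients multiply like matrices,
  `hasSum_matCoeff_mul`. Convergence is obtained without a Hilbert space: the expansion of
  `h₂ z^n` converges absolutely on a polydisc that contains the image of a small polydisc under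
  `h₁`, provided `∑ |b_j(h₁)| |c_j(h₂)| < |a(h₁)| |a(h₂)|`. On `SU(1,d)` this is the
  Cauchy-Schwarz inequality together with `‖b‖² = ‖c‖² = |a|² - 1`. This is the product formula.
* The generating kernel `∑ (σ)_{|n|} / n! matCoeff σ h m n z^m w^n = (a + c·z - b·w - zDw)^(-σ)` is
  visibly symmetric under `z ↔ w`, `(a, b, c, D) ↔ (a, -c, -b, Dᵗ)`; comparing coefficients gives
  `wt_mul_matCoeff`. Applied to `(1, 1, -1, -Uᵗ)` this is the duality `M_m(n; U) = M_n(m; Uᵗ)`.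
  Since `g⁻¹` has the blocks `(conj a, -conj c, -conj b, D†)`, it is also the unitarity of the
  action (`wt_mul_matCoeff_inv`), and the product formula for `g g⁻¹ = 1` and `g⁻¹ g = 1` becomes
  the two orthogonality relations.
* The monomials are orthogonal on the ball for the weight `(1 - ‖z‖²)^(σ-d-1)`, with squared norms
  proportional to `m! / (σ)_{|m|}` (`setIntegral_unitBall`, by a Gaussian integral and a Laplace
  transform). Integrating the expansion of the image of `z^n` against `conj z^m` term by term leaves
  the coefficient of `z^m`, which is the integral formula.
-/

noncomputable section

namespace MeixnerSU

/-! ### Power series with a majorant on a polydisc -/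

section Expansion

variable {d : ℕ}

theorem norm_mpow (z : Fin d → ℂ) (n : Fin d → ℕ) : ‖mpow z n‖ = ∏ i, ‖z i‖ ^ n i := by
  simp [mpow, norm_prod]

theorem mpow_zero (z : Fin d → ℂ) : mpow z 0 = 1 := by simp [mpow]

theorem mpow_ne_zero {z : Fin d → ℂ} (hz : ∀ i, z i ≠ 0) (n : Fin d → ℕ) : mpow z n ≠ 0 :=
  Finset.prod_ne_zero_iff.mpr fun i _ => pow_ne_zero _ (hz i)

theorem mpow_mul (x y : Fin d → ℂ) (n : Fin d → ℕ) :
    mpow (fun i => x i * y i) n = mpow x n * mpow y n := by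
  simp [mpow, mul_pow, Finset.prod_mul_distrib]

theorem mpow_inv (x : Fin d → ℂ) (n : Fin d → ℕ) :
    mpow (fun i => (x i)⁻¹) n = (mpow x n)⁻¹ := by
  simp [mpow]

theorem mpow_const_mul (x : ℂ) (y : Fin d → ℂ) (n : Fin d → ℕ) :
    mpow (fun i => x * y i) n = x ^ mdeg n * mpow y n := by
  simp [mpow, mdeg, mul_pow, Finset.prod_mul_distrib, Finset.prod_pow_eq_pow_sum]

/-- The coefficients `c` define a power series that converges absolutely on the closed polydisc
of polyradius `r`, has sum `f` there, and satisfies `∑ₙ |cₙ| rⁿ ≤ N`. -/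
structure Expands (r : Fin d → ℝ) (f : (Fin d → ℂ) → ℂ) (c : (Fin d → ℕ) → ℂ) (N : ℝ) :
    Prop where
  summable : Summable fun n => ‖c n‖ * ∏ i, r i ^ n i
  tsum_le : ∑' n, ‖c n‖ * ∏ i, r i ^ n i ≤ N
  hasSum : ∀ z : Fin d → ℂ, (∀ i, ‖z i‖ ≤ r i) → HasSum (fun n => c n * mpow z n) (f z)

theorem norm_mpow_le {r : Fin d → ℝ} {z : Fin d → ℂ} (hz : ∀ i, ‖z i‖ ≤ r i)
    (n : Fin d → ℕ) : ‖mpow z n‖ ≤ ∏ i, r i ^ n i := by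
  rw [norm_mpow]
  exact Finset.prod_le_prod (fun i _ => by positivity) fun i _ =>
    pow_le_pow_left₀ (norm_nonneg _) (hz i) _

theorem Expands.of_le {r : Fin d → ℝ} {f : (Fin d → ℂ) → ℂ} {c : (Fin d → ℕ) → ℂ} {N N' : ℝ}
    (h : Expands r f c N) (hN : N ≤ N') : Expands r f c N' :=
  ⟨h.summable, h.tsum_le.trans hN, h.hasSum⟩

theorem Expands.nonneg {r : Fin d → ℝ} (hr : ∀ i, 0 < r i) {f : (Fin d → ℂ) → ℂ}
    {c : (Fin d → ℕ) → ℂ} {N : ℝ} (h : Expands r f c N) : 0 ≤ N :=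
  le_trans (tsum_nonneg fun _ => mul_nonneg (norm_nonneg _)
    (Finset.prod_nonneg fun i _ => pow_nonneg (hr i).le _)) h.tsum_le

theorem Expands.congr {r : Fin d → ℝ} {f g : (Fin d → ℂ) → ℂ} {c : (Fin d → ℕ) → ℂ} {N : ℝ}
    (h : Expands r f c N) (hfg : ∀ z : Fin d → ℂ, (∀ i, ‖z i‖ ≤ r i) → f z = g z) :
    Expands r g c N :=
  ⟨h.summable, h.tsum_le, fun z hz => hfg z hz ▸ h.hasSum z hz⟩

theorem eventually_norm_le {r : Fin d → ℝ} (hr : ∀ i, 0 < r i) :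
    ∀ᶠ z in 𝓝 (0 : Fin d → ℂ), ∀ i, ‖z i‖ ≤ r i := by
  refine eventually_all.mpr fun i => ?_
  have : Continuous fun z : Fin d → ℂ => ‖z i‖ := by fun_prop
  refine (this.continuousAt.eventually_lt continuousAt_const ?_).mono fun z hz => hz.le
  simpa using hr i

/-- Collecting equal monomials does not increase the majorant. -/
theorem Expands.of_family {ι : Type*} {r : Fin d → ℝ} (hr : ∀ i, 0 < r i)
    {f : (Fin d → ℂ) → ℂ} (φ : ι → (Fin d → ℕ)) (w : ι → ℂ)
    (hs : Summable fun i => ‖w i‖ * ∏ j, r j ^ φ i j)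
    (hf : ∀ z : Fin d → ℂ, (∀ i, ‖z i‖ ≤ r i) → HasSum (fun i => w i * mpow z (φ i)) (f z)) :
    Expands r f (fun n => ∑' i : {i // φ i = n}, w i) (∑' i, ‖w i‖ * ∏ j, r j ^ φ i j) := by
  have hpos : ∀ n : Fin d → ℕ, 0 < ∏ j, r j ^ n j := fun _ =>
    Finset.prod_pos fun j _ => pow_pos (hr j) _
  have h1 := (Equiv.sigmaFiberEquiv φ).hasSum_iff.mpr hs.hasSum
  have h1s := h1.summable
  have hw : ∀ n, Summable fun i : {i // φ i = n} => ‖w i‖ := by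
    intro n
    have h2 : Summable fun i : {i // φ i = n} => ‖w i‖ * ∏ j, r j ^ φ i j := h1s.sigma_factor n
    have h3 : (fun i : {i // φ i = n} => ‖w i‖ * ∏ j, r j ^ φ i j)
        = fun i : {i // φ i = n} => ‖w i‖ * ∏ j, r j ^ n j := by
      funext i; rw [i.2]
    rw [h3] at h2
    exact (summable_mul_right_iff (hpos n).ne').mp h2
  have h4 : HasSum (fun n => (∑' i : {i // φ i = n}, ‖w i‖) * ∏ j, r j ^ n j)
      (∑' i, ‖w i‖ * ∏ j, r j ^ φ i j) := by
    refine h1.sigma fun n => ?_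
    have := (hw n).hasSum.mul_right (∏ j, r j ^ n j)
    refine this.congr_fun fun i => ?_
    simp only [Function.comp, Equiv.sigmaFiberEquiv, Equiv.coe_fn_mk]
    rw [i.2]
  have hle : ∀ n, ‖∑' i : {i // φ i = n}, w i‖ * ∏ j, r j ^ n j
      ≤ (∑' i : {i // φ i = n}, ‖w i‖) * ∏ j, r j ^ n j := fun n =>
    mul_le_mul_of_nonneg_right (norm_tsum_le_tsum_norm (hw n)) (hpos n).le
  have h5 : Summable fun n => ‖∑' i : {i // φ i = n}, w i‖ * ∏ j, r j ^ n j :=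
    Summable.of_nonneg_of_le (fun n => mul_nonneg (norm_nonneg _) (hpos n).le) hle h4.summable
  refine ⟨h5, ?_, fun z hz => hasSum_regroup φ w z _ (hf z hz)⟩
  rw [← h4.tsum_eq]
  exact h5.tsum_le_tsum hle h4.summable

theorem Expands.mul {r : Fin d → ℝ} (hr : ∀ i, 0 < r i) {f g : (Fin d → ℂ) → ℂ}
    {c e : (Fin d → ℕ) → ℂ} {N K : ℝ} (hf : Expands r f c N) (hg : Expands r g e K) :
    ∃ q, Expands r (fun z => f z * g z) q (N * K) := by
  have hnn : ∀ (c : (Fin d → ℕ) → ℂ) n, 0 ≤ ‖c n‖ * ∏ i, r i ^ n i := fun c n =>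
    mul_nonneg (norm_nonneg _) (Finset.prod_nonneg fun i _ => pow_nonneg (hr i).le _)
  have he : ∀ i : (Fin d → ℕ) × (Fin d → ℕ), ‖c i.1 * e i.2‖ * ∏ j, r j ^ (i.1 + i.2) j
      = (‖c i.1‖ * ∏ j, r j ^ i.1 j) * (‖e i.2‖ * ∏ j, r j ^ i.2 j) := by
    intro i
    simp only [Pi.add_apply, pow_add, Finset.prod_mul_distrib, norm_mul]
    ring
  have hs : Summable fun i : (Fin d → ℕ) × (Fin d → ℕ) =>
      ‖c i.1 * e i.2‖ * ∏ j, r j ^ (i.1 + i.2) j := by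
    simp only [he]
    exact hf.summable.mul_of_nonneg hg.summable (hnn c) (hnn e)
  have h := Expands.of_family hr (f := fun z => f z * g z)
    (fun i : (Fin d → ℕ) × (Fin d → ℕ) => i.1 + i.2)
    (fun i => c i.1 * e i.2) hs fun z hz => by
      have h1 := hf.hasSum z hz
      have h2 := hg.hasSum z hz
      have h3 := h1.mul h2 (summable_mul_of_summable_norm (f := fun n => c n * mpow z n)
        (g := fun n => e n * mpow z n) h1.summable.norm h2.summable.norm)
      refine h3.congr_fun fun i => ?_
      rw [mpow_add]; ring
  refine ⟨_, h.of_le ?_⟩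
  simp only [he]
  simp only [he] at hs
  refine (hf.summable.tsum_mul_tsum hg.summable hs).symm.le.trans ?_
  exact mul_le_mul hf.tsum_le hg.tsum_le (tsum_nonneg (hnn e)) (hf.nonneg hr)

theorem expands_const (r : Fin d → ℝ) (x : ℂ) :
    ∃ q, Expands r (fun _ => x) q ‖x‖ := by
  have h : HasSum (fun n : Fin d → ℕ => ‖if n = 0 then x else 0‖ * ∏ i, r i ^ n i) ‖x‖ := by
    refine (hasSum_ite_eq (0 : Fin d → ℕ) ‖x‖).congr_fun fun n => ?_
    by_cases h : n = 0
    · subst h; simp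
    · simp [h]
  refine ⟨fun n => if n = 0 then x else 0, h.summable, h.tsum_eq.le, fun z _ => ?_⟩
  refine (hasSum_ite_eq (0 : Fin d → ℕ) x).congr_fun fun n => ?_
  by_cases h : n = 0
  · subst h; simp [mpow]
  · simp [h]

theorem Expands.pow {r : Fin d → ℝ} (hr : ∀ i, 0 < r i) {f : (Fin d → ℂ) → ℂ}
    {c : (Fin d → ℕ) → ℂ} {N : ℝ} (hf : Expands r f c N) (k : ℕ) :
    ∃ q, Expands r (fun z => f z ^ k) q (N ^ k) := by
  induction k with
  | zero => simpa using expands_const r (1 : ℂ)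
  | succ k ih =>
    obtain ⟨q, hq⟩ := ih
    simpa [pow_succ] using hq.mul hr hf

theorem Expands.prod {ι : Type*} {r : Fin d → ℝ} (hr : ∀ i, 0 < r i) (s : Finset ι)
    (f : ι → (Fin d → ℂ) → ℂ) (N : ι → ℝ) (h : ∀ i, ∃ c, Expands r (f i) c (N i)) :
    ∃ q, Expands r (fun z => ∏ i ∈ s, f i z) q (∏ i ∈ s, N i) := by
  classical
  induction s using Finset.induction_on with
  | empty => simpa using expands_const r (1 : ℂ)
  | insert a s ha ih =>
    obtain ⟨q, hq⟩ := ih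
    obtain ⟨c, hc⟩ := h a
    simpa [Finset.prod_insert ha] using hc.mul hr hq

/-- An affine function is a polynomial; its majorant is the sum of the moduli of its terms. -/
theorem expands_affine {r : Fin d → ℝ} (hr : ∀ i, 0 < r i) (x : ℂ) (u : Fin d → ℂ) :
    ∃ q, Expands r (fun z => x + ∑ j, z j * u j) q (‖x‖ + ∑ j, r j * ‖u j‖) := by
  classical
  let φ : Option (Fin d) → (Fin d → ℕ) := fun o => o.elim 0 fun j => Pi.single j 1
  let w : Option (Fin d) → ℂ := fun o => o.elim x u
  have hm : ∀ (z : Fin d → ℂ) (j : Fin d), mpow z (Pi.single j 1) = z j := by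
    intro z j
    rw [mpow, Finset.prod_eq_single j]
    · simp
    · intro i _ hi; simp [hi]
    · simp
  have hm' : ∀ j : Fin d, ∏ i, r i ^ (Pi.single j 1 : Fin d → ℕ) i = r j := by
    intro j
    rw [Finset.prod_eq_single j]
    · simp
    · intro i _ hi; simp [hi]
    · simp
  have h := Expands.of_family hr (f := fun z => x + ∑ j, z j * u j) φ w (Summable.of_finite)
    fun z _ => by
      have := hasSum_fintype fun i => w i * mpow z (φ i)
      rw [Fintype.sum_option] at this
      simpa [w, φ, hm, mpow_zero, mul_comm] using this
  refine ⟨_, h.of_le (le_of_eq ?_)⟩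
  rw [tsum_fintype, Fintype.sum_option]
  simp [w, φ, hm', mul_comm]

/-- A series of expansions, `∑ᵢ wᵢ fᵢ` with `∑ᵢ |wᵢ| Nᵢ < ∞`, may be expanded term by term: the
double series of all monomials converges absolutely. -/
theorem hasSum_prod_expands {ι : Type*} {r : Fin d → ℝ} (hr : ∀ i, 0 < r i)
    (f : ι → (Fin d → ℂ) → ℂ) (c : ι → (Fin d → ℕ) → ℂ) (N : ι → ℝ) (w : ι → ℂ)
    (h : ∀ i, Expands r (f i) (c i) (N i)) (hs : Summable fun i => ‖w i‖ * N i) :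
    (Summable fun x : ι × (Fin d → ℕ) => ‖w x.1 * c x.1 x.2‖ * ∏ j, r j ^ x.2 j) ∧
    (∑' x : ι × (Fin d → ℕ), ‖w x.1 * c x.1 x.2‖ * ∏ j, r j ^ x.2 j ≤ ∑' i, ‖w i‖ * N i) ∧
    ∀ (F : ℂ) (z : Fin d → ℂ), (∀ i, ‖z i‖ ≤ r i) → HasSum (fun i => w i * f i z) F →
      HasSum (fun x : ι × (Fin d → ℕ) => w x.1 * c x.1 x.2 * mpow z x.2) F := by
  have hpos : ∀ n : Fin d → ℕ, 0 < ∏ j, r j ^ n j := fun _ =>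
    Finset.prod_pos fun j _ => pow_pos (hr j) _
  have hf : ∀ i, HasSum (fun n => ‖w i * c i n‖ * ∏ j, r j ^ n j)
      (‖w i‖ * ∑' n, ‖c i n‖ * ∏ j, r j ^ n j) := fun i => by
    simpa [mul_assoc] using (h i).summable.hasSum.mul_left ‖w i‖
  have hle : ∀ i, ‖w i‖ * ∑' n, ‖c i n‖ * ∏ j, r j ^ n j ≤ ‖w i‖ * N i := fun i =>
    mul_le_mul_of_nonneg_left (h i).tsum_le (norm_nonneg _)
  have hsum : Summable fun i => ‖w i‖ * ∑' n, ‖c i n‖ * ∏ j, r j ^ n j :=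
    Summable.of_nonneg_of_le (fun i => mul_nonneg (norm_nonneg _) (tsum_nonneg fun n =>
      mul_nonneg (norm_nonneg _) (hpos n).le)) hle hs
  have h1 : Summable fun x : ι × (Fin d → ℕ) => ‖w x.1 * c x.1 x.2‖ * ∏ j, r j ^ x.2 j := by
    rw [summable_prod_of_nonneg fun x => mul_nonneg (norm_nonneg _) (hpos _).le]
    refine ⟨fun i => (hf i).summable, ?_⟩
    simpa only [(hf _).tsum_eq] using hsum
  refine ⟨h1, ?_, fun F z hz hF => ?_⟩
  · have := h1.hasSum.prod_fiberwise hf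
    rw [← this.tsum_eq]
    exact hsum.tsum_le_tsum hle hs
  · have h2 : Summable fun x : ι × (Fin d → ℕ) => w x.1 * c x.1 x.2 * mpow z x.2 := by
      refine Summable.of_norm (Summable.of_nonneg_of_le (fun _ => norm_nonneg _) (fun x => ?_) h1)
      rw [norm_mul]
      exact mul_le_mul_of_nonneg_left (norm_mpow_le hz _) (norm_nonneg _)
    have h3 := h2.hasSum.prod_fiberwise (g := fun i => w i * f i z) fun i => by
      simpa [mul_assoc] using ((h i).hasSum z hz).mul_left (w i)
    exact h3.unique hF ▸ h2.hasSum

/-- The coefficients of a series of expansions are the sums of the coefficients. -/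
theorem Expands.tsum {ι : Type*} {r : Fin d → ℝ} (hr : ∀ i, 0 < r i)
    (f : ι → (Fin d → ℂ) → ℂ) (c : ι → (Fin d → ℕ) → ℂ) (N : ι → ℝ) (w : ι → ℂ)
    (h : ∀ i, Expands r (f i) (c i) (N i)) (hs : Summable fun i => ‖w i‖ * N i)
    (F : (Fin d → ℂ) → ℂ)
    (hF : ∀ z : Fin d → ℂ, (∀ i, ‖z i‖ ≤ r i) → HasSum (fun i => w i * f i z) (F z)) :
    (∀ n, Summable fun i => w i * c i n) ∧
      Expands r F (fun n => ∑' i, w i * c i n) (∑' i, ‖w i‖ * N i) := by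
  have hpos : ∀ n : Fin d → ℕ, 0 < ∏ j, r j ^ n j := fun _ =>
    Finset.prod_pos fun j _ => pow_pos (hr j) _
  obtain ⟨h1, h2, h3⟩ := hasSum_prod_expands hr f c N w h hs
  have h1' := h1.prod_symm
  have hn : ∀ n, Summable fun i => ‖w i * c i n‖ := fun n =>
    (summable_mul_right_iff (hpos n).ne').mp (h1'.prod_factor n)
  have h4 : HasSum (fun n => (∑' i, ‖w i * c i n‖) * ∏ j, r j ^ n j)
      (∑' x : ι × (Fin d → ℕ), ‖w x.1 * c x.1 x.2‖ * ∏ j, r j ^ x.2 j) := by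
    have h5 : HasSum (fun x : (Fin d → ℕ) × ι => ‖w x.2 * c x.2 x.1‖ * ∏ j, r j ^ x.1 j)
        (∑' x : ι × (Fin d → ℕ), ‖w x.1 * c x.1 x.2‖ * ∏ j, r j ^ x.2 j) :=
      (Equiv.prodComm (Fin d → ℕ) ι).hasSum_iff
        (f := fun x : ι × (Fin d → ℕ) => ‖w x.1 * c x.1 x.2‖ * ∏ j, r j ^ x.2 j) |>.mpr h1.hasSum
    exact h5.prod_fiberwise fun n => (hn n).hasSum.mul_right _
  have hle : ∀ n, ‖∑' i, w i * c i n‖ * ∏ j, r j ^ n j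
      ≤ (∑' i, ‖w i * c i n‖) * ∏ j, r j ^ n j := fun n =>
    mul_le_mul_of_nonneg_right (norm_tsum_le_tsum_norm (hn n)) (hpos n).le
  have h6 : Summable fun n => ‖∑' i, w i * c i n‖ * ∏ j, r j ^ n j :=
    Summable.of_nonneg_of_le (fun n => mul_nonneg (norm_nonneg _) (hpos n).le) hle h4.summable
  have hc : ∀ n, Summable fun i => w i * c i n := fun n => (hn n).of_norm
  refine ⟨hc, h6, ?_, fun z hz => ?_⟩
  · exact (h6.tsum_le_tsum hle h4.summable).trans (h4.tsum_eq.le.trans h2)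
  · have h5 : HasSum (fun x : (Fin d → ℕ) × ι => w x.2 * c x.2 x.1 * mpow z x.1) (F z) :=
      (Equiv.prodComm (Fin d → ℕ) ι).hasSum_iff
        (f := fun x : ι × (Fin d → ℕ) => w x.1 * c x.1 x.2 * mpow z x.2) |>.mpr
          (h3 (F z) z hz (hF z hz))
    exact h5.prod_fiberwise fun n => (hc n).hasSum.mul_right (mpow z n)

/-- The inverse of an affine function, by the geometric series. -/
theorem expands_affine_inv {r : Fin d → ℝ} (hr : ∀ i, 0 < r i) (x : ℂ) (u : Fin d → ℂ)
    (hx : ∑ j, r j * ‖u j‖ < ‖x‖) :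
    ∃ q, Expands r (fun z => (x + ∑ j, z j * u j)⁻¹) q (‖x‖ - ∑ j, r j * ‖u j‖)⁻¹ := by
  have hnn : 0 ≤ ∑ j, r j * ‖u j‖ :=
    Finset.sum_nonneg fun j _ => mul_nonneg (hr j).le (norm_nonneg _)
  have hxpos : 0 < ‖x‖ := hnn.trans_lt hx
  have hx0 : x ≠ 0 := norm_pos_iff.mp hxpos
  obtain ⟨q, hq⟩ := expands_affine hr 0 u
  rw [norm_zero, zero_add] at hq
  choose e he using fun k => hq.pow hr k
  have hρ : (∑ j, r j * ‖u j‖) / ‖x‖ < 1 := (div_lt_one hxpos).mpr hx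
  have hg := (hasSum_geometric_of_lt_one (div_nonneg hnn hxpos.le) hρ).mul_left ‖x‖⁻¹
  have hw : ∀ k : ℕ, ‖x⁻¹ * (-x⁻¹) ^ k‖ * (∑ j, r j * ‖u j‖) ^ k
      = ‖x‖⁻¹ * ((∑ j, r j * ‖u j‖) / ‖x‖) ^ k := by
    intro k
    rw [norm_mul, norm_pow, norm_neg, norm_inv, div_eq_mul_inv, mul_pow]
    ring
  have h := Expands.tsum hr (fun k z => (0 + ∑ j, z j * u j) ^ k) e _
    (fun k : ℕ => x⁻¹ * (-x⁻¹) ^ k) he (by simpa only [hw] using hg.summable)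
    (fun z => (x + ∑ j, z j * u j)⁻¹) fun z hz => by
      have hle : ‖∑ j, z j * u j‖ ≤ ∑ j, r j * ‖u j‖ := by
        refine (norm_sum_le _ _).trans (Finset.sum_le_sum fun j _ => ?_)
        rw [norm_mul]
        exact mul_le_mul_of_nonneg_right (hz j) (norm_nonneg _)
      have hlt : ‖-x⁻¹ * ∑ j, z j * u j‖ < 1 := by
        rw [norm_mul, norm_neg, norm_inv, inv_mul_lt_one₀ hxpos]
        exact hle.trans_lt hx
      have h1 := (hasSum_geometric_of_norm_lt_one hlt).mul_left x⁻¹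
      have h2 : x⁻¹ * (1 - -x⁻¹ * ∑ j, z j * u j)⁻¹ = (x + ∑ j, z j * u j)⁻¹ := by
        rw [← mul_inv]
        congr 1
        field_simp
        ring
      rw [h2] at h1
      refine h1.congr_fun fun k => ?_
      rw [mul_pow, zero_add, mul_assoc]
  refine ⟨_, h.2.of_le (le_of_eq ?_)⟩
  simp only [hw]
  rw [hg.tsum_eq, ← mul_inv]
  congr 1
  field_simp

/-- The Taylor coefficients at `0` of a function with a convergent expansion (unspecified for other
functions). They are unique by `eq_zero_of_expansion`. -/
def taylorCoeff (f : (Fin d → ℂ) → ℂ) : (Fin d → ℕ) → ℂ :=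
  Classical.epsilon fun c => ∀ᶠ t in 𝓝 (0 : Fin d → ℂ), HasSum (fun n => c n * mpow t n) (f t)

theorem taylorCoeff_eq {f : (Fin d → ℂ) → ℂ} {c : (Fin d → ℕ) → ℂ}
    (h : ∀ᶠ t in 𝓝 (0 : Fin d → ℂ), HasSum (fun n => c n * mpow t n) (f t)) :
    taylorCoeff f = c := by
  have h1 : ∀ᶠ t in 𝓝 (0 : Fin d → ℂ), HasSum (fun n => taylorCoeff f n * mpow t n) (f t) :=
    Classical.epsilon_spec (p := fun c : (Fin d → ℕ) → ℂ =>
      ∀ᶠ t in 𝓝 (0 : Fin d → ℂ), HasSum (fun n => c n * mpow t n) (f t)) ⟨c, h⟩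
  have h2 := eq_zero_of_expansion (fun n => taylorCoeff f n - c n) (by
    filter_upwards [h, h1] with t ht h1t
    simpa [sub_mul] using h1t.sub ht)
  funext n
  exact sub_eq_zero.mp (congrFun h2 n)

theorem Expands.taylorCoeff_eq {r : Fin d → ℝ} (hr : ∀ i, 0 < r i) {f : (Fin d → ℂ) → ℂ}
    {c : (Fin d → ℕ) → ℂ} {N : ℝ} (h : Expands r f c N) : taylorCoeff f = c :=
  MeixnerSU.taylorCoeff_eq ((eventually_norm_le hr).mono fun z hz => h.hasSum z hz)

end Expansion

/-! ### Matrix coefficients of the action of matrices on monomials -/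

section MatrixCoefficients

variable {d : ℕ}

/-- The entries of the row vector `(1, z) h`. -/
def aff (h : Matrix (Fin (d + 1)) (Fin (d + 1)) ℂ) (z : Fin d → ℂ) (k : Fin (d + 1)) : ℂ :=
  h 0 k + ∑ j, z j * h j.succ k

/-- The fractional linear action of `h` from the right, `(1, z) h = aff h z 0 • (1, proj h z)`.
This is meaningful only where `aff h z 0 ≠ 0`. -/
def proj (h : Matrix (Fin (d + 1)) (Fin (d + 1)) ℂ) (z : Fin d → ℂ) (i : Fin d) : ℂ :=
  aff h z i.succ / aff h z 0

/-- The image of the monomial `z^n` under the weight `σ` action of `h`,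
`(h f)(z) = (aff h z 0)^(-σ) f (proj h z)`. -/
def monomialImage (σ : ℕ) (h : Matrix (Fin (d + 1)) (Fin (d + 1)) ℂ) (n : Fin d → ℕ)
    (z : Fin d → ℂ) : ℂ :=
  (aff h z 0)⁻¹ ^ σ * mpow (proj h z) n

/-- The coefficient of `z^m` in the image of `z^n` under the weight `σ` action of `h`. -/
def matCoeff (σ : ℕ) (h : Matrix (Fin (d + 1)) (Fin (d + 1)) ℂ) (m n : Fin d → ℕ) : ℂ :=
  taylorCoeff (monomialImage σ h n) m

theorem monomialImage_eq (σ : ℕ) (h : Matrix (Fin (d + 1)) (Fin (d + 1)) ℂ) (n : Fin d → ℕ)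
    (z : Fin d → ℂ) :
    monomialImage σ h n z = (aff h z 0)⁻¹ ^ (σ + mdeg n) * ∏ i, aff h z i.succ ^ n i := by
  simp only [monomialImage, proj, mpow, mdeg, div_eq_mul_inv, mul_pow, Finset.prod_mul_distrib,
    pow_add, Finset.prod_pow_eq_pow_sum]
  ring

theorem aff_mul (g h : Matrix (Fin (d + 1)) (Fin (d + 1)) ℂ) (z : Fin d → ℂ)
    (hz : aff g z 0 ≠ 0) (k : Fin (d + 1)) :
    aff (g * h) z k = aff g z 0 * aff h (proj g z) k := by
  have h1 : aff (g * h) z k = ∑ l, aff g z l * h l k := by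
    simp only [aff, Matrix.mul_apply, add_mul, Finset.sum_add_distrib, Finset.mul_sum,
      Finset.sum_mul]
    rw [Finset.sum_comm]
    simp only [mul_assoc]
  rw [h1, Fin.sum_univ_succ, aff.eq_def h, mul_add, Finset.mul_sum]
  congr 1
  refine Finset.sum_congr rfl fun i _ => ?_
  rw [proj]
  field_simp

/-- The cocycle property that makes the weight `σ` action a homomorphism. -/
theorem monomialImage_mul (σ : ℕ) (g h : Matrix (Fin (d + 1)) (Fin (d + 1)) ℂ) (n : Fin d → ℕ)
    (z : Fin d → ℂ) (hz : aff g z 0 ≠ 0) :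
    monomialImage σ (g * h) n z = (aff g z 0)⁻¹ ^ σ * monomialImage σ h n (proj g z) := by
  have h1 : proj (g * h) z = proj h (proj g z) := by
    funext i
    rw [proj, aff_mul g h z hz, aff_mul g h z hz, mul_div_mul_left _ _ hz, proj]
  rw [monomialImage, monomialImage, h1, aff_mul g h z hz, mul_inv, mul_pow, mul_assoc]

theorem le_norm_aff {h : Matrix (Fin (d + 1)) (Fin (d + 1)) ℂ} {r : Fin d → ℝ} {A : ℝ}
    (hA : A + ∑ j, r j * ‖h j.succ 0‖ ≤ ‖h 0 0‖) {z : Fin d → ℂ} (hz : ∀ i, ‖z i‖ ≤ r i) :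
    A ≤ ‖aff h z 0‖ := by
  have h1 : ‖∑ j, z j * h j.succ 0‖ ≤ ∑ j, r j * ‖h j.succ 0‖ := by
    refine (norm_sum_le _ _).trans (Finset.sum_le_sum fun j _ => ?_)
    rw [norm_mul]
    exact mul_le_mul_of_nonneg_right (hz j) (norm_nonneg _)
  have h2 : ‖h 0 0‖ ≤ ‖aff h z 0‖ + ‖∑ j, z j * h j.succ 0‖ := by
    have := norm_sub_le (aff h z 0) (∑ j, z j * h j.succ 0)
    simpa [aff] using this
  linarith

theorem norm_proj_le {h : Matrix (Fin (d + 1)) (Fin (d + 1)) ℂ} {r ρ : Fin d → ℝ} {A : ℝ}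
    (hA0 : 0 < A) (hA : A + ∑ j, r j * ‖h j.succ 0‖ ≤ ‖h 0 0‖)
    (hρ : ∀ i, ‖h 0 i.succ‖ + ∑ j, r j * ‖h j.succ i.succ‖ ≤ A * ρ i)
    {z : Fin d → ℂ} (hz : ∀ i, ‖z i‖ ≤ r i) (i : Fin d) : ‖proj h z i‖ ≤ ρ i := by
  have h1 := le_norm_aff hA hz
  have h2 : ‖aff h z i.succ‖ ≤ A * ρ i := by
    refine (norm_add_le _ _).trans (le_trans ?_ (hρ i))
    gcongr
    refine (norm_sum_le _ _).trans (Finset.sum_le_sum fun j _ => ?_)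
    rw [norm_mul]
    exact mul_le_mul_of_nonneg_right (hz j) (norm_nonneg _)
  have h3 : 0 ≤ ρ i := nonneg_of_mul_nonneg_right ((norm_nonneg _).trans h2) hA0
  rw [proj, norm_div, div_le_iff₀ (hA0.trans_le h1)]
  calc _ ≤ A * ρ i := h2
    _ ≤ ‖aff h z 0‖ * ρ i := by gcongr
    _ = _ := mul_comm _ _

/-- The image of `z^n` expands on every polydisc of polyradius `r` on which the denominator is
bounded below by `A`, with a majorant that is geometric in `n`. -/
theorem expands_monomialImage (σ : ℕ) {h : Matrix (Fin (d + 1)) (Fin (d + 1)) ℂ}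
    {r ρ : Fin d → ℝ} {A : ℝ} (hr : ∀ i, 0 < r i) (hA0 : 0 < A)
    (hA : A + ∑ j, r j * ‖h j.succ 0‖ ≤ ‖h 0 0‖)
    (hρ : ∀ i, ‖h 0 i.succ‖ + ∑ j, r j * ‖h j.succ i.succ‖ ≤ A * ρ i) (n : Fin d → ℕ) :
    Expands r (monomialImage σ h n) (fun m => matCoeff σ h m n) (A⁻¹ ^ σ * ∏ i, ρ i ^ n i) := by
  obtain ⟨q₁, hq₁⟩ := expands_affine_inv hr (h 0 0) (fun j => h j.succ 0) (by linarith)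
  obtain ⟨q₂, hq₂⟩ := hq₁.pow hr (σ + mdeg n)
  have h3 : ∀ i : Fin d, ∃ q, Expands r (fun z => aff h z i.succ ^ n i) q
      ((‖h 0 i.succ‖ + ∑ j, r j * ‖h j.succ i.succ‖) ^ n i) := fun i => by
    obtain ⟨q, hq⟩ := expands_affine hr (h 0 i.succ) (fun j => h j.succ i.succ)
    exact hq.pow hr (n i)
  obtain ⟨q₄, hq₄⟩ := Expands.prod hr Finset.univ _ _ h3
  obtain ⟨q, hq⟩ := hq₂.mul hr hq₄
  have hq' : Expands r (monomialImage σ h n) q _ := hq.congr fun z _ => by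
    rw [monomialImage_eq]; rfl
  have hc : (fun m => matCoeff σ h m n) = q := hq'.taylorCoeff_eq hr
  rw [hc]
  refine hq'.of_le ?_
  have hb : ∀ i : Fin d, 0 ≤ ‖h 0 i.succ‖ + ∑ j, r j * ‖h j.succ i.succ‖ := fun i =>
    add_nonneg (norm_nonneg _) (Finset.sum_nonneg fun j _ => mul_nonneg (hr j).le (norm_nonneg _))
  calc _ ≤ A⁻¹ ^ (σ + mdeg n) * ∏ i, (A * ρ i) ^ n i := by
        refine mul_le_mul ?_ ?_ (Finset.prod_nonneg fun i _ => pow_nonneg (hb i) _) (by positivity)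
        · refine pow_le_pow_left₀ (inv_nonneg.mpr (by linarith)) ?_ _
          exact inv_anti₀ hA0 (by linarith)
        · exact Finset.prod_le_prod (fun i _ => pow_nonneg (hb i) _) fun i _ =>
            pow_le_pow_left₀ (hb i) (hρ i) _
    _ = A⁻¹ ^ σ * ∏ i, ρ i ^ n i := by
        have : A⁻¹ ^ mdeg n * A ^ mdeg n = 1 := by
          rw [← mul_pow, inv_mul_cancel₀ hA0.ne', one_pow]
        simp only [mul_pow, Finset.prod_mul_distrib, Finset.prod_pow_eq_pow_sum, pow_add]
        change _ * A⁻¹ ^ mdeg n * (A ^ mdeg n * _) = _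
        linear_combination (A⁻¹ ^ σ * ∏ i, ρ i ^ n i) * this

theorem exists_expands_monomialImage (σ : ℕ) {h : Matrix (Fin (d + 1)) (Fin (d + 1)) ℂ}
    {r : Fin d → ℝ} (hr : ∀ i, 0 < r i) (hlt : ∑ j, r j * ‖h j.succ 0‖ < ‖h 0 0‖)
    (n : Fin d → ℕ) :
    ∃ N, Expands r (monomialImage σ h n) (fun m => matCoeff σ h m n) N := by
  have hA0 : 0 < ‖h 0 0‖ - ∑ j, r j * ‖h j.succ 0‖ := by linarith
  exact ⟨_, expands_monomialImage σ hr hA0 (by linarith) (ρ := fun i =>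
    (‖h 0 i.succ‖ + ∑ j, r j * ‖h j.succ i.succ‖) / (‖h 0 0‖ - ∑ j, r j * ‖h j.succ 0‖))
    (fun i => by rw [mul_div_cancel₀ _ hA0.ne']) n⟩

theorem eventually_hasSum_monomialImage (σ : ℕ) {h : Matrix (Fin (d + 1)) (Fin (d + 1)) ℂ}
    (h0 : h 0 0 ≠ 0) (n : Fin d → ℕ) : ∀ᶠ z in 𝓝 (0 : Fin d → ℂ),
      HasSum (fun m => matCoeff σ h m n * mpow z m) (monomialImage σ h n z) := by
  have h1 : ∀ᶠ ε in 𝓝[>] (0 : ℝ), ∑ j : Fin d, ε * ‖h j.succ 0‖ < ‖h 0 0‖ := by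
    have : Continuous fun ε : ℝ => ∑ j : Fin d, ε * ‖h j.succ 0‖ := by fun_prop
    refine (this.continuousAt.eventually_lt continuousAt_const ?_).filter_mono
      nhdsWithin_le_nhds
    simpa using h0
  obtain ⟨ε, hε, hε0⟩ := (h1.and self_mem_nhdsWithin).exists
  obtain ⟨N, hN⟩ := exists_expands_monomialImage σ (r := fun _ => ε) (fun _ => hε0) hε n
  exact (eventually_norm_le (r := fun _ : Fin d => ε) fun _ => hε0).mono fun z hz => hN.hasSum z hz

/-- The matrix coefficients multiply like matrices: the expansion of the image of `z^n` under `h`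
may be substituted into the action of `g`, because `proj g` maps a small polydisc into a polydisc on
which that expansion converges absolutely. -/
theorem hasSum_matCoeff_mul (σ : ℕ) (g h : Matrix (Fin (d + 1)) (Fin (d + 1)) ℂ)
    (hg : g 0 0 ≠ 0)
    (hlt : ∑ j : Fin d, ‖g 0 j.succ‖ * ‖h j.succ 0‖ < ‖g 0 0‖ * ‖h 0 0‖) (m n : Fin d → ℕ) :
    HasSum (fun k => matCoeff σ g m k * matCoeff σ h k n) (matCoeff σ (g * h) m n) := by
  let A : ℝ → ℝ := fun ε => ‖g 0 0‖ - ∑ j : Fin d, ε * ‖g j.succ 0‖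
  -- On the polydisc of radius `ε`, `A ε` bounds the denominator of `proj g` from below and `B ε i`
  -- its numerators from above; the last summand of `B` makes the new polyradii positive.
  let B : ℝ → Fin d → ℝ := fun ε i => ‖g 0 i.succ‖ + ∑ j : Fin d, ε * ‖g j.succ i.succ‖ + ε
  have hAc : Continuous A := by fun_prop
  have hBc : Continuous fun ε => ∑ i, B ε i * ‖h i.succ 0‖ := by fun_prop
  have h1 : ∀ᶠ ε in 𝓝[>] (0 : ℝ), 0 < A ε := by
    refine (continuousAt_const.eventually_lt hAc.continuousAt ?_).filter_mono nhdsWithin_le_nhds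
    simpa [A] using hg
  have h2 : ∀ᶠ ε in 𝓝[>] (0 : ℝ), ∑ i, B ε i * ‖h i.succ 0‖ < A ε * ‖h 0 0‖ := by
    refine (hBc.continuousAt.eventually_lt (hAc.mul continuous_const).continuousAt ?_).filter_mono
      nhdsWithin_le_nhds
    simpa [A, B] using hlt
  obtain ⟨ε, ⟨hA, hB⟩, hε⟩ := ((h1.and h2).and self_mem_nhdsWithin).exists
  have hε0 : 0 < ε := hε
  have hr : ∀ i : Fin d, 0 < (fun _ => ε) i := fun _ => hε0
  have hBpos : ∀ i, 0 < B ε i := fun i => by positivity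
  have hρ : ∀ i, 0 < B ε i / A ε := fun i => div_pos (hBpos i) hA
  have hA' : A ε + ∑ j : Fin d, ε * ‖g j.succ 0‖ ≤ ‖g 0 0‖ := by simp [A]
  have hρ' : ∀ i : Fin d, ‖g 0 i.succ‖ + ∑ j : Fin d, ε * ‖g j.succ i.succ‖
      ≤ A ε * (B ε i / A ε) := fun i => by
    rw [mul_div_cancel₀ _ hA.ne']
    simp only [B]; linarith
  obtain ⟨N, hN⟩ := exists_expands_monomialImage σ (h := h) hρ (by
    have : ∀ j : Fin d, B ε j / A ε * ‖h j.succ 0‖ = (B ε j * ‖h j.succ 0‖) / A ε := fun j => by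
      ring
    simp only [this]
    rw [← Finset.sum_div, div_lt_iff₀ hA, mul_comm]
    exact hB) n
  have hs : Summable fun k : Fin d → ℕ =>
      ‖matCoeff σ h k n‖ * ((A ε)⁻¹ ^ σ * ∏ i, (B ε i / A ε) ^ k i) := by
    refine (hN.summable.mul_left ((A ε)⁻¹ ^ σ)).congr fun k => ?_
    ring
  obtain ⟨h5, h6⟩ := Expands.tsum hr (fun k => monomialImage σ g k)
    (fun k m => matCoeff σ g m k) _ (fun k => matCoeff σ h k n)
    (expands_monomialImage σ hr hA hA' hρ') hs (monomialImage σ (g * h) n) fun z hz => by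
      have h7 : aff g z 0 ≠ 0 := norm_pos_iff.mp (hA.trans_le (le_norm_aff hA' hz))
      rw [monomialImage_mul σ g h n z h7]
      have h8 := (hN.hasSum (proj g z) fun i => norm_proj_le hA hA' hρ' hz i).mul_left
        ((aff g z 0)⁻¹ ^ σ)
      refine h8.congr_fun fun k => ?_
      rw [monomialImage]; ring
  have h9 : matCoeff σ (g * h) m n = ∑' k, matCoeff σ h k n * matCoeff σ g m k :=
    congrFun (h6.taylorCoeff_eq hr) m
  rw [h9]
  refine (h5 m).hasSum.congr_fun fun k => mul_comm _ _

theorem matCoeff_one (σ : ℕ) (m n : Fin d → ℕ) :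
    matCoeff σ (1 : Matrix (Fin (d + 1)) (Fin (d + 1)) ℂ) m n = if m = n then 1 else 0 := by
  have h0 : ∀ z : Fin d → ℂ, aff 1 z 0 = 1 := fun z => by
    simp [aff, Fin.succ_ne_zero]
  have h1 : ∀ z : Fin d → ℂ, proj 1 z = z := fun z => by
    funext i
    rw [proj, h0]
    simp [aff, Matrix.one_apply, (Fin.succ_ne_zero _).symm]
  refine congrFun (taylorCoeff_eq (f := monomialImage σ 1 n)
    (c := fun m => if m = n then 1 else 0) (Eventually.of_forall fun z => ?_)) m
  rw [monomialImage, h0, h1]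
  rw [inv_one, one_pow, one_mul]
  refine (hasSum_ite_eq n (mpow z n)).congr_fun fun k => ?_
  by_cases hk : k = n
  · simp [hk]
  · simp [hk]

/-- Complex conjugation of the matrix conjugates the coefficients. -/
theorem matCoeff_map_conj (σ : ℕ) {h : Matrix (Fin (d + 1)) (Fin (d + 1)) ℂ} (h0 : h 0 0 ≠ 0)
    (m n : Fin d → ℕ) : matCoeff σ (h.map conj) m n = conj (matCoeff σ h m n) := by
  have ha : ∀ (z : Fin d → ℂ) k, aff (h.map conj) z k = conj (aff h (fun i => conj (z i)) k) :=
    fun z k => by simp [aff]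
  have hm : ∀ (z : Fin d → ℂ) (n : Fin d → ℕ),
      mpow (fun i => conj (z i)) n = conj (mpow z n) := fun z n => by simp [mpow]
  have hp : ∀ z : Fin d → ℂ,
      proj (h.map conj) z = fun i => conj (proj h (fun i => conj (z i)) i) := fun z => by
    funext i; simp [proj, ha]
  refine congrFun (taylorCoeff_eq (f := monomialImage σ (h.map conj) n)
    (c := fun m => conj (matCoeff σ h m n)) ?_) m
  have hc : Tendsto (fun z : Fin d → ℂ => fun i => conj (z i)) (𝓝 0) (𝓝 0) := by
    have : Continuous fun z : Fin d → ℂ => fun i => conj (z i) := by fun_prop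
    have h2 := this.tendsto 0
    simp only [Pi.zero_apply, map_zero] at h2
    exact h2
  filter_upwards [hc.eventually (eventually_hasSum_monomialImage σ h0 n)] with z hz
  have h1 : monomialImage σ (h.map conj) n z
      = conj (monomialImage σ h n fun i => conj (z i)) := by
    rw [monomialImage, monomialImage, ha, hp, hm]
    simp
  rw [h1]
  refine (Complex.hasSum_conj'.mpr hz).congr_fun fun k => ?_
  rw [hm, map_mul, Complex.conj_conj]

end MatrixCoefficients

/-! ### Transposition of matrix coefficients -/

section Transposition

variable {d : ℕ}

/-- The weight `(σ)_{|n|} / n!`: its inverse is the squared norm of `z^n` for the inner product that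
the action of `SU(1,d)` preserves. -/
def wt (σ : ℕ) (n : Fin d → ℕ) : ℂ := poch σ (mdeg n) / (mfact n : ℂ)

theorem natCast_ne_neg {σ : ℕ} (hσ : 0 < σ) (k : ℕ) : (σ : ℂ) ≠ -(k : ℂ) := by
  intro h
  have : ((σ + k : ℕ) : ℂ) = 0 := by push_cast; rw [h]; ring
  have := Nat.cast_eq_zero.mp this
  omega

theorem wt_ne_zero {σ : ℕ} (hσ : 0 < σ) (n : Fin d → ℕ) : wt σ n ≠ 0 :=
  div_ne_zero (poch_ne_zero (natCast_ne_neg hσ) _) (mfact_ne_zero n)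

theorem poch_natCast (σ k : ℕ) : poch (σ : ℂ) k = (σ.ascFactorial k : ℕ) := by
  rw [poch, ← ascPochhammer_nat_eq_ascFactorial, ascPochhammer_eval_cast]

/-- The weight is a nonnegative real number. -/
theorem norm_wt (σ : ℕ) (n : Fin d → ℕ) :
    ((‖wt σ n‖ : ℝ) : ℂ) = wt σ n := by
  rw [wt, poch_natCast, norm_div, Complex.norm_natCast, Complex.norm_natCast]
  simp

/-- The binomial series `(1 - y)^(-σ) = ∑ₖ (σ)ₖ / k! y^k`. -/
theorem hasSum_poch {σ : ℕ} (hσ : 0 < σ) {y : ℂ} (hy : ‖y‖ < 1) :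
    HasSum (fun k : ℕ => poch (σ : ℂ) k / (k.factorial : ℂ) * y ^ k) ((1 - y)⁻¹ ^ σ) := by
  obtain ⟨s, rfl⟩ := Nat.exists_eq_succ_of_ne_zero hσ.ne'
  have h := hasSum_choose_mul_geometric_of_norm_lt_one s hy
  rw [one_div, ← inv_pow] at h
  refine h.congr_fun fun k => ?_
  rw [poch_natCast, Nat.succ_eq_add_one, Nat.ascFactorial_eq_factorial_mul_choose]
  have hk : (k.factorial : ℂ) ≠ 0 := by exact_mod_cast k.factorial_ne_zero
  push_cast
  rw [mul_div_cancel_left₀ _ hk, ← Nat.choose_symm_add, add_comm]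

theorem sum_piAntidiag_wt (σ k : ℕ) (x : Fin d → ℂ) :
    ∑ n ∈ Finset.piAntidiag Finset.univ k, wt σ n * mpow x n
      = poch (σ : ℂ) k / (k.factorial : ℂ) * (∑ i, x i) ^ k := by
  rw [Finset.sum_pow_eq_sum_piAntidiag, Finset.mul_sum]
  refine Finset.sum_congr rfl fun n hn => ?_
  have hd : mdeg n = k := by simpa [mdeg] using hn
  have h1 := Nat.multinomial_spec Finset.univ n
  change mfact n * _ = (mdeg n).factorial at h1
  rw [hd] at h1
  have h2 : (mfact n : ℂ) * (Nat.multinomial Finset.univ n : ℂ) = (k.factorial : ℂ) := by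
    exact_mod_cast h1
  have hk : (k.factorial : ℂ) ≠ 0 := by exact_mod_cast k.factorial_ne_zero
  have hm := mfact_ne_zero n
  rw [wt, hd, mpow]
  have h3 : (Nat.multinomial Finset.univ n : ℂ) = (k.factorial : ℂ) / (mfact n : ℂ) := by
    rw [← h2]; field_simp
  rw [h3]
  field_simp

/-- The multinomial series `(1 - |x|)^(-σ) = ∑ₙ (σ)_{|n|} / n! x^n`. -/
theorem hasSum_wt {σ : ℕ} (hσ : 0 < σ) {x : Fin d → ℂ} (hx : ∑ i, ‖x i‖ < 1) :
    HasSum (fun n => wt σ n * mpow x n) ((1 - ∑ i, x i)⁻¹ ^ σ) := by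
  have hset : ∀ (n : Fin d → ℕ) k, n ∈ Finset.piAntidiag Finset.univ k ↔ mdeg n = k := by
    intro n k; simp [mdeg]
  have hfib : ∀ {E : Type} [AddCommMonoid E] [TopologicalSpace E] (F : (Fin d → ℕ) → E) (k : ℕ),
      HasSum (fun n : {n : Fin d → ℕ // mdeg n = k} => F n)
        (∑ n ∈ Finset.piAntidiag Finset.univ k, F n) := fun F k =>
    ((Equiv.subtypeEquivRight fun n => hset n k).hasSum_iff
      (f := fun n : {n : Fin d → ℕ // mdeg n = k} => F n)).mp
        (Finset.hasSum (Finset.piAntidiag Finset.univ k) F)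
  have hρ : 0 ≤ ∑ i, ‖x i‖ := Finset.sum_nonneg fun _ _ => norm_nonneg _
  have hnorm : ∀ k, ∑ n ∈ Finset.piAntidiag Finset.univ k, ‖wt σ n * mpow x n‖
      = ‖poch (σ : ℂ) k / (k.factorial : ℂ) * ((∑ i, ‖x i‖ : ℝ) : ℂ) ^ k‖ := by
    intro k
    have h1 := sum_piAntidiag_wt σ k fun i => ((‖x i‖ : ℝ) : ℂ)
    have h2 : ∀ n : Fin d → ℕ, wt σ n * mpow (fun i => ((‖x i‖ : ℝ) : ℂ)) n
        = ((‖wt σ n * mpow x n‖ : ℝ) : ℂ) := fun n => by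
      rw [norm_mul, Complex.ofReal_mul, norm_wt, norm_mpow]
      simp [mpow]
    simp only [h2] at h1
    rw [← Complex.ofReal_sum, ← Complex.ofReal_sum] at h1
    rw [← h1, Complex.norm_real, Real.norm_of_nonneg (Finset.sum_nonneg fun _ _ => norm_nonneg _)]
  have hs : Summable fun n => wt σ n * mpow x n := by
    refine Summable.of_norm ?_
    refine (Equiv.sigmaFiberEquiv (mdeg (d := d))).summable_iff
      (f := fun n => ‖wt σ n * mpow x n‖) |>.mp ?_
    refine (summable_sigma_of_nonneg fun _ => norm_nonneg _).mpr ?_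
    refine ⟨fun k => (hfib (fun n => ‖wt σ n * mpow x n‖) k).summable, ?_⟩
    have h3 := (hasSum_poch hσ (y := ((∑ i, ‖x i‖ : ℝ) : ℂ))
      (by rwa [Complex.norm_real, Real.norm_of_nonneg hρ])).summable.norm
    refine h3.congr fun k => ?_
    rw [← hnorm k]
    exact (hfib (fun n => ‖wt σ n * mpow x n‖) k).tsum_eq.symm
  have h4 := (Equiv.sigmaFiberEquiv (mdeg (d := d))).hasSum_iff
    (f := fun n => wt σ n * mpow x n) |>.mpr hs.hasSum
  have h5 := h4.sigma fun k => hfib (fun n => wt σ n * mpow x n) k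
  simp only [sum_piAntidiag_wt] at h5
  have h6 := h5.unique (hasSum_poch hσ ((norm_sum_le _ _).trans_lt hx))
  exact h6 ▸ hs.hasSum

/-- The generating kernel of the matrix coefficients, `(a + c·z - b·w - zDw)^(-σ)`. -/
def kernel (σ : ℕ) (h : Matrix (Fin (d + 1)) (Fin (d + 1)) ℂ) (z w : Fin d → ℂ) : ℂ :=
  (aff h z 0 - ∑ i, w i * aff h z i.succ)⁻¹ ^ σ

/-- `signedTranspose h` has the blocks `(a, -c; -b, Dᵗ)`. -/
def signedTranspose (h : Matrix (Fin (d + 1)) (Fin (d + 1)) ℂ) :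
    Matrix (Fin (d + 1)) (Fin (d + 1)) ℂ :=
  J d * hᵀ * J d

theorem signedTranspose_apply (h : Matrix (Fin (d + 1)) (Fin (d + 1)) ℂ) (i j : Fin (d + 1)) :
    signedTranspose h i j = (Fin.cons 1 fun _ => -1 : Fin (d + 1) → ℂ) i * h j i
      * (Fin.cons 1 fun _ => -1 : Fin (d + 1) → ℂ) j := by
  rw [signedTranspose, J, Matrix.mul_diagonal, Matrix.diagonal_mul, Matrix.transpose_apply]

theorem kernel_signedTranspose (σ : ℕ) (h : Matrix (Fin (d + 1)) (Fin (d + 1)) ℂ)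
    (z w : Fin d → ℂ) :
    kernel σ (signedTranspose h) w z = kernel σ h z w := by
  have h1 : aff (signedTranspose h) w 0 - ∑ i, z i * aff (signedTranspose h) w i.succ
      = aff h z 0 - ∑ i, w i * aff h z i.succ := by
    simp only [aff, signedTranspose_apply, Fin.cons_zero, Fin.cons_succ, mul_add,
      Finset.sum_add_distrib, Finset.mul_sum]
    rw [Finset.sum_comm]
    simp only [one_mul, mul_one, neg_mul, mul_neg, Finset.sum_neg_distrib, neg_neg]
    have : ∀ i j, z j * (w i * h j.succ i.succ) = w i * (z j * h j.succ i.succ) := fun i j => by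
      ring
    simp only [this]
    ring
  rw [kernel, kernel, h1]

/-- Near the origin the double series with the matrix coefficients converges to the kernel. -/
theorem eventually_hasSum_kernel {σ : ℕ} (hσ : 0 < σ) {h : Matrix (Fin (d + 1)) (Fin (d + 1)) ℂ}
    (h0 : h 0 0 ≠ 0) : ∀ᶠ ε in 𝓝[>] (0 : ℝ), ∀ z w : Fin d → ℂ, (∀ i, ‖z i‖ ≤ ε) →
      (∀ i, ‖w i‖ ≤ ε) → HasSum (fun x : (Fin d → ℕ) × (Fin d → ℕ) =>
        wt σ x.1 * matCoeff σ h x.2 x.1 * mpow w x.1 * mpow z x.2) (kernel σ h z w) := by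
  have hA : 0 < ‖h 0 0‖ / 2 := half_pos (norm_pos_iff.mpr h0)
  let B : ℝ → Fin d → ℝ := fun ε i =>
    (‖h 0 i.succ‖ + ∑ j : Fin d, ε * ‖h j.succ i.succ‖) / (‖h 0 0‖ / 2)
  have h1 : ∀ᶠ ε in 𝓝[>] (0 : ℝ), ∑ j : Fin d, ε * ‖h j.succ 0‖ < ‖h 0 0‖ / 2 := by
    have : Continuous fun ε : ℝ => ∑ j : Fin d, ε * ‖h j.succ 0‖ := by fun_prop
    refine (this.continuousAt.eventually_lt continuousAt_const ?_).filter_mono nhdsWithin_le_nhds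
    simpa using h0
  have h2 : ∀ᶠ ε in 𝓝[>] (0 : ℝ), ∑ i, ε * B ε i < 1 := by
    have : Continuous fun ε : ℝ => ∑ i, ε * B ε i := by fun_prop
    refine (this.continuousAt.eventually_lt continuousAt_const ?_).filter_mono nhdsWithin_le_nhds
    simp
  filter_upwards [h1, h2, self_mem_nhdsWithin] with ε hε1 hε2 hε z w hz hw
  have hε0 : 0 < ε := hε
  have hr : ∀ i : Fin d, 0 < (fun _ => ε) i := fun _ => hε0
  have hB0 : ∀ i, 0 ≤ B ε i := fun i => by positivity
  have hA' : ‖h 0 0‖ / 2 + ∑ j : Fin d, ε * ‖h j.succ 0‖ ≤ ‖h 0 0‖ := by linarith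
  have hρ' : ∀ i : Fin d, ‖h 0 i.succ‖ + ∑ j : Fin d, ε * ‖h j.succ i.succ‖
      ≤ ‖h 0 0‖ / 2 * B ε i := fun i => by
    simp only [B]
    rw [mul_div_cancel₀ _ hA.ne']
  have hw' : ∑ i, ‖w i‖ * B ε i < 1 := lt_of_le_of_lt (Finset.sum_le_sum fun i _ =>
    mul_le_mul_of_nonneg_right (hw i) (hB0 i)) hε2
  have hs : Summable fun n : Fin d → ℕ =>
      ‖wt σ n * mpow w n‖ * ((‖h 0 0‖ / 2)⁻¹ ^ σ * ∏ i, B ε i ^ n i) := by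
    have h3 := (hasSum_wt hσ (x := fun i => w i * (B ε i : ℂ)) (by
      simpa [abs_of_nonneg (hB0 _)] using hw')).summable.norm.mul_left ((‖h 0 0‖ / 2)⁻¹ ^ σ)
    refine h3.congr fun n => ?_
    have h4 : ‖mpow (fun i => (B ε i : ℂ)) n‖ = ∏ i, B ε i ^ n i := by
      rw [norm_mpow]
      simp [abs_of_nonneg (hB0 _)]
    rw [mpow_mul, norm_mul, norm_mul, norm_mul, h4]
    ring
  obtain ⟨-, -, h5⟩ := hasSum_prod_expands hr (fun n => monomialImage σ h n)
    (fun n m => matCoeff σ h m n) _ (fun n => wt σ n * mpow w n)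
    (expands_monomialImage σ hr hA hA' hρ') hs
  suffices h8 : HasSum (fun n => wt σ n * mpow w n * monomialImage σ h n z) (kernel σ h z w) by
    refine (h5 (kernel σ h z w) z hz h8).congr_fun fun x => ?_
    ring
  have hproj := norm_proj_le hA hA' hρ' hz
  have hne : aff h z 0 ≠ 0 := norm_pos_iff.mp (hA.trans_le (le_norm_aff hA' hz))
  have hx : ∑ i, ‖w i * proj h z i‖ < 1 := by
    refine lt_of_le_of_lt (Finset.sum_le_sum fun i _ => ?_) hw'
    rw [norm_mul]
    exact mul_le_mul_of_nonneg_left (hproj i) (norm_nonneg _)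
  have h6 := (hasSum_wt hσ hx).mul_left ((aff h z 0)⁻¹ ^ σ)
  have h7 : (aff h z 0)⁻¹ ^ σ * (1 - ∑ i, w i * proj h z i)⁻¹ ^ σ = kernel σ h z w := by
    rw [kernel, ← mul_pow, ← mul_inv, mul_sub, mul_one, Finset.mul_sum]
    congr 3
    refine Finset.sum_congr rfl fun i _ => ?_
    rw [proj]
    field_simp
  rw [h7] at h6
  refine h6.congr_fun fun n => ?_
  rw [monomialImage, mpow_mul]
  ring

/-- Uniqueness of double power series, from uniqueness first in `w` and then in `z`. -/
theorem eq_zero_of_double_expansion (e : (Fin d → ℕ) × (Fin d → ℕ) → ℂ)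
    (h : ∃ ε > 0, ∀ z w : Fin d → ℂ, (∀ i, ‖z i‖ ≤ ε) → (∀ i, ‖w i‖ ≤ ε) →
      HasSum (fun x => e x * mpow w x.1 * mpow z x.2) 0) : e = 0 := by
  obtain ⟨ε, hε, h⟩ := h
  have hε' : ∀ i : Fin d, ‖((fun _ => (ε : ℂ)) : Fin d → ℂ) i‖ ≤ ε := fun i => by
    simp [abs_of_pos hε]
  have hne : ∀ n : Fin d → ℕ, mpow (fun _ => (ε : ℂ)) n ≠ 0 := fun n =>
    mpow_ne_zero (fun _ => by exact_mod_cast hε.ne') n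
  have hs : ∀ (z : Fin d → ℂ) n, (∀ i, ‖z i‖ ≤ ε) →
      Summable fun m => e (n, m) * mpow z m := fun z n hz => by
    have h1 := (h z _ hz hε').summable.prod_factor n
    have h2 : (fun m => e (n, m) * mpow (fun _ => (ε : ℂ)) n * mpow z m)
        = fun m => mpow (fun _ => (ε : ℂ)) n * (e (n, m) * mpow z m) := by funext m; ring
    simp only [h2] at h1
    exact (summable_mul_left_iff (hne n)).mp h1
  have h3 : ∀ z : Fin d → ℂ, (∀ i, ‖z i‖ ≤ ε) → (fun n => ∑' m, e (n, m) * mpow z m) = 0 := by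
    intro z hz
    refine eq_zero_of_expansion _ ?_
    filter_upwards [eventually_norm_le (r := fun _ : Fin d => ε) fun _ => hε] with w hw
    refine (h z w hz hw).prod_fiberwise fun n => ?_
    refine ((hs z n hz).hasSum.mul_right (mpow w n)).congr_fun fun m => ?_
    ring
  funext ⟨n, m⟩
  refine congrFun (eq_zero_of_expansion (fun m => e (n, m)) ?_) m
  filter_upwards [eventually_norm_le (r := fun _ : Fin d => ε) fun _ => hε] with z hz
  have h4 : ∑' m, e (n, m) * mpow z m = 0 := congrFun (h3 z hz) n
  exact h4 ▸ (hs z n hz).hasSum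

/-- The symmetry of the kernel under `signedTranspose`, read off from its coefficients. -/
theorem wt_mul_matCoeff {σ : ℕ} (hσ : 0 < σ) {h : Matrix (Fin (d + 1)) (Fin (d + 1)) ℂ}
    (h0 : h 0 0 ≠ 0) (m n : Fin d → ℕ) :
    wt σ n * matCoeff σ h m n = wt σ m * matCoeff σ (signedTranspose h) n m := by
  have h0' : signedTranspose h 0 0 ≠ 0 := by simpa [signedTranspose_apply] using h0
  obtain ⟨ε, ⟨h1, h2⟩, hε⟩ := ((eventually_hasSum_kernel hσ h0).and
    (eventually_hasSum_kernel hσ h0')).and self_mem_nhdsWithin |>.exists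
  have h3 := eq_zero_of_double_expansion (fun x : (Fin d → ℕ) × (Fin d → ℕ) =>
    wt σ x.1 * matCoeff σ h x.2 x.1 - wt σ x.2 * matCoeff σ (signedTranspose h) x.1 x.2)
    ⟨ε, hε, fun z w hz hw => by
      have h4 := h1 z w hz hw
      have h5 := (Equiv.prodComm _ _).hasSum_iff (f := fun x : (Fin d → ℕ) × (Fin d → ℕ) =>
        wt σ x.1 * matCoeff σ (signedTranspose h) x.2 x.1 * mpow z x.1 * mpow w x.2) |>.mpr
          (h2 w z hw hz)
      rw [kernel_signedTranspose] at h5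
      have h6 := h4.sub h5
      rw [sub_self] at h6
      refine h6.congr_fun fun x => ?_
      simp only [Function.comp, Equiv.prodComm_apply, Prod.fst_swap, Prod.snd_swap]
      ring⟩
  exact sub_eq_zero.mp (congrFun h3 (n, m))

end Transposition

/-! ### Meixner polynomials as matrix coefficients -/

section MeixnerCoefficients

variable {d : ℕ}

/-- At a multi-index `n` the powers in the generating function have integer exponents. -/
theorem genFun_natCast (σ : ℕ) (n : Fin d → ℕ) (t : Fin d → ℂ) (V : Matrix (Fin d) (Fin d) ℂ) :
    genFun (fun i => (n i : ℂ)) t V (σ : ℂ)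
      = (1 - ∑ j, t j)⁻¹ ^ (σ + mdeg n) * ∏ i, (1 - ∑ j, V i j * t j) ^ n i := by
  have h1 : -(σ : ℂ) - ∑ i, (n i : ℂ) = -((σ + mdeg n : ℕ) : ℂ) := by
    simp only [mdeg]; push_cast; ring
  simp only [genFun]
  rw [h1, Complex.cpow_neg, Complex.cpow_natCast, inv_pow]
  simp only [Complex.cpow_natCast]

/-- The substitution `t_j = -(c_j / a) z_j` turns the generating function of the Meixner polynomials
into the image of `z^n`. -/
theorem matCoeff_eq_meixner {σ : ℕ} (hσ : 0 < σ) {h : Matrix (Fin (d + 1)) (Fin (d + 1)) ℂ}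
    (h0 : h 0 0 ≠ 0) (hb : ∀ i : Fin d, h 0 i.succ ≠ 0) (hc : ∀ j : Fin d, h j.succ 0 ≠ 0)
    {V : Matrix (Fin d) (Fin d) ℂ}
    (hV : ∀ i j, V i j = h 0 0 * h j.succ i.succ / (h 0 i.succ * h j.succ 0))
    (m n : Fin d → ℕ) :
    matCoeff σ h m n = (h 0 0)⁻¹ ^ σ * mpow (fun i => h 0 i.succ / h 0 0) n
      * (wt σ m * (-1) ^ mdeg m * mpow (fun j => h j.succ 0 / h 0 0) m * M σ V m n) := by
  refine congrFun (taylorCoeff_eq (f := monomialImage σ h n) (c := fun m =>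
    (h 0 0)⁻¹ ^ σ * mpow (fun i => h 0 i.succ / h 0 0) n
      * (wt σ m * (-1) ^ mdeg m * mpow (fun j => h j.succ 0 / h 0 0) m * M σ V m n)) ?_) m
  have hct : Tendsto (fun z : Fin d → ℂ => fun j => -1 * (h j.succ 0 / h 0 0 * z j))
      (𝓝 0) (𝓝 0) := by
    have : Continuous fun z : Fin d → ℂ => fun j => -1 * (h j.succ 0 / h 0 0 * z j) := by fun_prop
    have h2 := this.tendsto 0
    simp only [Pi.zero_apply, mul_zero] at h2
    exact h2
  filter_upwards [hct.eventually
    (isMeixnerFamily_meixner (fun i => (n i : ℂ)) V (natCast_ne_neg hσ))] with z hz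
  have h1 : 1 - ∑ j, -1 * (h j.succ 0 / h 0 0 * z j) = (h 0 0)⁻¹ * aff h z 0 := by
    rw [aff, mul_add, inv_mul_cancel₀ h0, Finset.mul_sum, sub_eq_add_neg,
      ← Finset.sum_neg_distrib]
    congr 1
    refine Finset.sum_congr rfl fun j _ => ?_
    field_simp
  have h2 : ∀ i, 1 - ∑ j, V i j * (-1 * (h j.succ 0 / h 0 0 * z j))
      = (h 0 i.succ)⁻¹ * aff h z i.succ := fun i => by
    rw [aff, mul_add, inv_mul_cancel₀ (hb i), Finset.mul_sum, sub_eq_add_neg,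
      ← Finset.sum_neg_distrib]
    congr 1
    refine Finset.sum_congr rfl fun j _ => ?_
    have := hb i
    have := hc j
    rw [hV]
    field_simp
  have h3 : (h 0 0)⁻¹ ^ σ * mpow (fun i => h 0 i.succ / h 0 0) n
      * genFun (fun i => (n i : ℂ)) (fun j => -1 * (h j.succ 0 / h 0 0 * z j)) V (σ : ℂ)
      = monomialImage σ h n z := by
    have h4 : mpow (fun i => h 0 i.succ) n ≠ 0 := mpow_ne_zero hb n
    simp only [genFun_natCast, h1, h2]
    rw [monomialImage_eq]
    simp only [mul_pow, Finset.prod_mul_distrib, div_eq_mul_inv, mpow_mul, mul_inv, inv_inv,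
      pow_add]
    change _ * (_ * mpow (fun _ => (h 0 0)⁻¹) n) * (_ * (mpow (fun i => (h 0 i.succ)⁻¹) n * _)) = _
    have h5 : mpow (fun _ : Fin d => (h 0 0)⁻¹) n = ((h 0 0) ^ mdeg n)⁻¹ := by
      simp [mpow, mdeg, Finset.prod_pow_eq_pow_sum]
    rw [h5, mpow_inv, inv_pow]
    field_simp
  rw [← h3]
  refine (hz.mul_left _).congr_fun fun k => ?_
  rw [mpow_const_mul, mpow_mul]
  simp only [wt, M]
  ring

/-- Duality `M_m(n; V) = M_n(m; Vᵗ)`: the matrix with blocks `(1, 1; -1, -Vᵗ)` is carried by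
`signedTranspose` to the one built in the same way from `Vᵗ`. -/
theorem meixner_transpose {σ : ℕ} (hσ : 0 < σ) (V : Matrix (Fin d) (Fin d) ℂ) (m n : Fin d → ℕ) :
    M σ V m n = M σ Vᵀ n m := by
  let h : Matrix (Fin d) (Fin d) ℂ → Matrix (Fin (d + 1)) (Fin (d + 1)) ℂ := fun W =>
    Matrix.of fun i j =>
      Fin.cases (Fin.cases 1 (fun _ => 1) j) (fun i' => Fin.cases (-1) (fun j' => -W j' i') j) i
  have e00 : ∀ W, h W 0 0 = 1 := fun W => rfl
  have e01 : ∀ W (j : Fin d), h W 0 j.succ = 1 := fun W j => rfl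
  have e10 : ∀ W (j : Fin d), h W j.succ 0 = -1 := fun W j => rfl
  have e11 : ∀ W (i j : Fin d), h W i.succ j.succ = -W j i := fun W i j => rfl
  have hsymm : signedTranspose (h V) = h Vᵀ := by
    ext i j
    rw [signedTranspose_apply]
    refine Fin.cases ?_ (fun i => ?_) i <;> refine Fin.cases ?_ (fun j => ?_) j <;>
      simp [e00, e01, e10, e11]
  have key : ∀ W (m n : Fin d → ℕ), matCoeff σ (h W) m n = wt σ m * M σ W m n := fun W m n => by
    rw [matCoeff_eq_meixner hσ (by simp [e00]) (by simp [e01]) (by simp [e10]) (V := W)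
      (fun i j => by simp [e00, e01, e10, e11]) m n]
    have h1 : mpow (fun _ : Fin d => (-1 : ℂ)) m = (-1) ^ mdeg m := by
      simp [mpow, mdeg, Finset.prod_pow_eq_pow_sum]
    have h2 : mpow (fun _ : Fin d => (1 : ℂ)) n = 1 := by simp [mpow]
    have h3 : (-1 : ℂ) ^ mdeg m * (-1) ^ mdeg m = 1 := by rw [← mul_pow]; simp
    simp only [e00, e01, e10, div_one, h1, h2, inv_one, one_pow, one_mul]
    linear_combination (wt σ m * M σ W m n) * h3
  have h1 := wt_mul_matCoeff hσ (h := h V) (by simp [e00]) m n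
  rw [hsymm, key, key] at h1
  have := wt_ne_zero hσ m
  have := wt_ne_zero hσ n
  have h2 : wt σ m * wt σ n * M σ V m n = wt σ m * wt σ n * M σ Vᵀ n m := by
    linear_combination h1
  exact mul_left_cancel₀ (by positivity) h2

/-! ### Matrix coefficients of `SU(1,d)` -/

/-- The inverse in `SU(1,d)` is `J g† J`. -/
theorem coe_inv_eq (g : SU d) : (g⁻¹).1.1 = (signedTranspose g.1.1).map conj := by
  have h1 : (signedTranspose g.1.1).map conj = J d * (g.1.1)ᴴ * J d := by
    ext i j
    rw [Matrix.map_apply, signedTranspose_apply, J, Matrix.mul_diagonal, Matrix.diagonal_mul,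
      Matrix.conjTranspose_apply]
    have : ∀ i : Fin (d + 1), conj ((Fin.cons 1 fun _ => -1 : Fin (d + 1) → ℂ) i)
        = (Fin.cons 1 fun _ => -1 : Fin (d + 1) → ℂ) i := fun i =>
      Fin.cases (by simp) (fun i => by simp) i
    rw [map_mul, map_mul, this, this]
    rfl
  have hJ : J d * J d = 1 := by
    rw [J, Matrix.diagonal_mul_diagonal, ← Matrix.diagonal_one]
    congr 1
    funext i
    refine Fin.cases ?_ (fun i => ?_) i <;> simp
  have hg : (g.1.1)ᴴ * J d * g.1.1 = J d := g.2
  have h2 : J d * (g.1.1)ᴴ * J d * g.1.1 = 1 := by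
    calc J d * (g.1.1)ᴴ * J d * g.1.1 = J d * ((g.1.1)ᴴ * J d * g.1.1) := by
          simp only [Matrix.mul_assoc]
      _ = 1 := by rw [hg, hJ]
  have h3 : g.1.1 * (g⁻¹).1.1 = 1 := by
    change (g * g⁻¹).1.1 = 1
    rw [mul_inv_cancel]
    rfl
  rw [h1]
  calc (g⁻¹).1.1 = (J d * (g.1.1)ᴴ * J d * g.1.1) * (g⁻¹).1.1 := by rw [h2, one_mul]
    _ = J d * (g.1.1)ᴴ * J d := by rw [Matrix.mul_assoc, h3, mul_one]

theorem sum_norm_c_sq (g : SU d) : ∑ j, ‖c g j‖ ^ 2 = ‖a g‖ ^ 2 - 1 := by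
  have hg : (g.1.1)ᴴ * J d * g.1.1 = J d := g.2
  have h1 := congrFun (congrFun hg 0) 0
  rw [Matrix.mul_apply, Fin.sum_univ_succ] at h1
  simp only [J, Matrix.mul_diagonal, Matrix.conjTranspose_apply, Fin.cons_zero, Fin.cons_succ,
    mul_one, mul_neg, neg_mul, Matrix.diagonal_apply_eq, Finset.sum_neg_distrib] at h1
  have h2 : ∀ z : ℂ, star z * z = ((‖z‖ ^ 2 : ℝ) : ℂ) := fun z => by
    rw [mul_comm]; push_cast; exact Complex.mul_conj' z
  simp only [h2] at h1
  have h3 : ‖g.1.1 0 0‖ ^ 2 + -∑ j : Fin d, ‖g.1.1 j.succ 0‖ ^ 2 = 1 := by exact_mod_cast h1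
  simp only [c, a]
  linarith

theorem sum_norm_b_sq (g : SU d) : ∑ j, ‖b g j‖ ^ 2 = ‖a g‖ ^ 2 - 1 := by
  have h := sum_norm_c_sq g⁻¹
  have ha : ‖a g⁻¹‖ = ‖a g‖ := by
    rw [a, coe_inv_eq, Matrix.map_apply, signedTranspose_apply]
    simp [a]
  have hc : ∀ j, ‖c g⁻¹ j‖ = ‖b g j‖ := fun j => by
    rw [c, coe_inv_eq, Matrix.map_apply, signedTranspose_apply]
    simp [b]
  simpa only [ha, hc] using h

theorem one_le_norm_a_sq (g : SU d) : 1 ≤ ‖a g‖ ^ 2 := by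
  have h := sum_norm_c_sq g
  have : 0 ≤ ∑ j, ‖c g j‖ ^ 2 := Finset.sum_nonneg fun _ _ => by positivity
  linarith

theorem a_ne_zero (g : SU d) : a g ≠ 0 := by
  intro h
  have := one_le_norm_a_sq g
  norm_num [h] at this

theorem sum_norm_b_mul_norm_c_lt (g₁ g₂ : SU d) :
    ∑ j, ‖b g₁ j‖ * ‖c g₂ j‖ < ‖a g₁‖ * ‖a g₂‖ := by
  have h1 := Finset.sum_mul_sq_le_sq_mul_sq Finset.univ (fun j => ‖b g₁ j‖) fun j => ‖c g₂ j‖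
  rw [sum_norm_b_sq, sum_norm_c_sq] at h1
  have h2 := one_le_norm_a_sq g₁
  have h3 := one_le_norm_a_sq g₂
  refine lt_of_pow_lt_pow_left₀ 2 (by positivity) (h1.trans_lt ?_)
  rw [mul_pow]
  nlinarith

theorem hasSum_matCoeff_SU (σ : ℕ) (g₁ g₂ : SU d) (m n : Fin d → ℕ) :
    HasSum (fun k => matCoeff σ g₁.1.1 m k * matCoeff σ g₂.1.1 k n)
      (matCoeff σ (g₁ * g₂).1.1 m n) := by
  have h := hasSum_matCoeff_mul σ g₁.1.1 g₂.1.1 (a_ne_zero g₁) (sum_norm_b_mul_norm_c_lt g₁ g₂) m n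
  simpa using h

theorem conj_wt (σ : ℕ) (n : Fin d → ℕ) : conj (wt σ n) = wt σ n := by
  rw [← norm_wt, Complex.conj_ofReal]

/-- The action of `SU(1,d)` is unitary for the inner product in which the monomials are orthogonal
with `‖z^n‖² = n! / (σ)_{|n|}`. -/
theorem wt_mul_matCoeff_inv {σ : ℕ} (hσ : 0 < σ) (g : SU d) (m n : Fin d → ℕ) :
    wt σ m * matCoeff σ (g⁻¹).1.1 n m = wt σ n * conj (matCoeff σ g.1.1 m n) := by
  have h0 : signedTranspose g.1.1 0 0 ≠ 0 := by
    rw [signedTranspose_apply]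
    simpa using show g.1.1 0 0 ≠ 0 from a_ne_zero g
  have h1 := congrArg conj (wt_mul_matCoeff hσ (h := g.1.1) (a_ne_zero g) m n)
  rw [map_mul, map_mul, conj_wt, conj_wt] at h1
  rw [coe_inv_eq, matCoeff_map_conj σ h0, h1]

/-- `matCoeff_eq_meixner` in the parameters `p`, `p̃`, `U` of a generic element. -/
theorem matCoeff_generic {σ : ℕ} (hσ : 0 < σ) {g : SU d} (hg : IsGeneric g) (m n : Fin d → ℕ) :
    matCoeff σ g.1.1 m n = (a g)⁻¹ ^ σ * mpow (p g) n
      * (wt σ m * (-1) ^ mdeg m * mpow (pt g) m * M σ (U g) m n) :=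
  matCoeff_eq_meixner hσ hg.1 (fun i => (hg.2 i).1) (fun i => (hg.2 i).2) (fun _ _ => rfl) m n

theorem mpow_conj (x : Fin d → ℂ) (n : Fin d → ℕ) :
    mpow (fun i => conj (x i)) n = conj (mpow x n) := by simp [mpow]

theorem p0sq_pow (g : SU d) (σ : ℕ) :
    (p0sq g : ℂ) ^ σ = (a g)⁻¹ ^ σ * conj ((a g)⁻¹ ^ σ) := by
  have h : (p0sq g : ℂ) = (a g)⁻¹ * conj (a g)⁻¹ := by
    rw [Complex.mul_conj', p0sq, norm_inv]
    push_cast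
    rw [inv_pow]
  rw [h, mul_pow, map_pow]

/-- Orthogonality in the variable: the product formula for `g g⁻¹ = 1`. -/
theorem hasSum_meixner_orthogonal {σ : ℕ} (hσ : 0 < σ) {g : SU d} (hg : IsGeneric g)
    (m m' : Fin d → ℕ) :
    HasSum (fun n : Fin d → ℕ =>
        wt σ n * mpow (p g) n * mpow (fun i => conj (p g i)) n
          * M σ (U g) m n * conj (M σ (U g) m' n))
      (if m = m' then
        (mfact m : ℂ) * (mpow (pt g) m)⁻¹ * (mpow (fun i => conj (pt g i)) m)⁻¹
          / (poch σ (mdeg m) * (p0sq g : ℂ) ^ σ)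
      else 0) := by
  have ha : (a g)⁻¹ ^ σ ≠ 0 := pow_ne_zero _ (inv_ne_zero (a_ne_zero g))
  have hpt : ∀ m, mpow (pt g) m ≠ 0 := fun m =>
    mpow_ne_zero (fun i => div_ne_zero (hg.2 i).2 hg.1) m
  have hs : ∀ m : Fin d → ℕ, (-1 : ℂ) ^ mdeg m ≠ 0 := fun m => pow_ne_zero _ (by norm_num)
  have hK : (a g)⁻¹ ^ σ * (wt σ m * (-1) ^ mdeg m * mpow (pt g) m)
      * conj ((a g)⁻¹ ^ σ * (wt σ m' * (-1) ^ mdeg m' * mpow (pt g) m')) ≠ 0 := by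
    have hA : ∀ m : Fin d → ℕ, (a g)⁻¹ ^ σ * (wt σ m * (-1) ^ mdeg m * mpow (pt g) m) ≠ 0 :=
      fun m => mul_ne_zero ha (mul_ne_zero (mul_ne_zero (wt_ne_zero hσ m) (hs m)) (hpt m))
    exact mul_ne_zero (hA m) ((map_ne_zero _).mpr (hA m'))
  have h1 := ((hasSum_matCoeff_SU σ g g⁻¹ m m').mul_left (wt σ m')).mul_left
    ((a g)⁻¹ ^ σ * (wt σ m * (-1) ^ mdeg m * mpow (pt g) m)
      * conj ((a g)⁻¹ ^ σ * (wt σ m' * (-1) ^ mdeg m' * mpow (pt g) m')))⁻¹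
  have h2 : (g * g⁻¹).1.1 = (1 : Matrix (Fin (d + 1)) (Fin (d + 1)) ℂ) := by
    rw [mul_inv_cancel]; rfl
  rw [h2, matCoeff_one] at h1
  convert! h1 using 1
  · funext n
    rw [eq_inv_mul_iff_mul_eq₀ hK]
    have h3 := wt_mul_matCoeff_inv hσ g m' n
    rw [mul_left_comm (wt σ m') (matCoeff _ _ _ _), h3, matCoeff_generic hσ hg,
      matCoeff_generic hσ hg, mpow_conj]
    simp only [map_mul]
    ring
  · by_cases hm : m = m'
    · subst hm
      have hc1 := (map_ne_zero (starRingEnd ℂ)).mpr ha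
      have hc2 := (map_ne_zero (starRingEnd ℂ)).mpr (hpt m)
      have h4 := poch_ne_zero (natCast_ne_neg hσ) (mdeg m)
      have h5 := mfact_ne_zero m
      have h6 := hpt m
      have h7 : (-1 : ℂ) ^ mdeg m * (-1) ^ mdeg m = 1 := by rw [← mul_pow]; simp
      rw [if_pos rfl, if_pos rfl, eq_inv_mul_iff_mul_eq₀ hK, p0sq_pow, mpow_conj]
      simp only [map_mul, conj_wt, mul_one]
      have h8 : conj ((-1 : ℂ) ^ mdeg m) = (-1) ^ mdeg m := by simp
      rw [h8]
      generalize (-1 : ℂ) ^ mdeg m = s at *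
      generalize (a g)⁻¹ ^ σ = α at *
      rw [wt]
      field_simp
      linear_combination h7
    · simp [hm]

/-- Orthogonality in the degree: the product formula for `g⁻¹ g = 1`. -/
theorem hasSum_meixner_dual_orthogonal {σ : ℕ} (hσ : 0 < σ) {g : SU d} (hg : IsGeneric g)
    (n n' : Fin d → ℕ) :
    HasSum (fun m : Fin d → ℕ =>
        wt σ m * mpow (pt g) m * mpow (fun i => conj (pt g i)) m
          * M σ (U g) m n * conj (M σ (U g) m n'))
      (if n = n' then
        (mfact n : ℂ) * (mpow (p g) n)⁻¹ * (mpow (fun i => conj (p g i)) n)⁻¹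
          / (poch σ (mdeg n) * (p0sq g : ℂ) ^ σ)
      else 0) := by
  have ha : (a g)⁻¹ ^ σ ≠ 0 := pow_ne_zero _ (inv_ne_zero (a_ne_zero g))
  have hp : ∀ n, mpow (p g) n ≠ 0 := fun n =>
    mpow_ne_zero (fun i => div_ne_zero (hg.2 i).1 hg.1) n
  have hK : wt σ n' * ((a g)⁻¹ ^ σ * mpow (p g) n) * conj ((a g)⁻¹ ^ σ * mpow (p g) n') ≠ 0 :=
    mul_ne_zero (mul_ne_zero (wt_ne_zero hσ n') (mul_ne_zero ha (hp n)))
      ((map_ne_zero _).mpr (mul_ne_zero ha (hp n')))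
  have h1 := (hasSum_matCoeff_SU σ g⁻¹ g n' n).mul_left
    (wt σ n' * ((a g)⁻¹ ^ σ * mpow (p g) n) * conj ((a g)⁻¹ ^ σ * mpow (p g) n'))⁻¹
  have h2 : (g⁻¹ * g).1.1 = (1 : Matrix (Fin (d + 1)) (Fin (d + 1)) ℂ) := by
    rw [inv_mul_cancel]; rfl
  rw [h2, matCoeff_one] at h1
  convert! h1 using 1
  · funext m
    rw [eq_inv_mul_iff_mul_eq₀ hK]
    have h3 := wt_mul_matCoeff_inv hσ g m n'
    refine mul_left_cancel₀ (wt_ne_zero hσ m) ?_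
    have h7 : (-1 : ℂ) ^ mdeg m * (-1) ^ mdeg m = 1 := by rw [← mul_pow]; simp
    have h8 : conj ((-1 : ℂ) ^ mdeg m) = (-1) ^ mdeg m := by simp
    rw [← mul_assoc (wt σ m) (matCoeff _ _ _ _), h3, matCoeff_generic hσ hg,
      matCoeff_generic hσ hg, mpow_conj]
    simp only [map_mul, conj_wt, h8]
    generalize (-1 : ℂ) ^ mdeg m = s at *
    linear_combination (-(wt σ n' * ((a g)⁻¹ ^ σ * mpow (p g) n) * (conj ((a g)⁻¹ ^ σ)
      * conj (mpow (p g) n')) * wt σ m * wt σ m * mpow (pt g) m * conj (mpow (pt g) m)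
      * M σ (U g) m n * conj (M σ (U g) m n'))) * h7
  · by_cases hn : n = n'
    · subst hn
      have hc1 := (map_ne_zero (starRingEnd ℂ)).mpr ha
      have hc2 := (map_ne_zero (starRingEnd ℂ)).mpr (hp n)
      have h4 := poch_ne_zero (natCast_ne_neg hσ) (mdeg n)
      have h5 := mfact_ne_zero n
      have h6 := hp n
      rw [if_pos rfl, if_pos rfl, eq_inv_mul_iff_mul_eq₀ hK, p0sq_pow, mpow_conj]
      simp only [map_mul]
      generalize (a g)⁻¹ ^ σ = α at *
      rw [wt]
      field_simp
    · simp [hn, Ne.symm hn]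

/-- The product formula for matrix coefficients, divided by the factors that do not depend on the
summation index. -/
theorem hasSum_meixner_mul {σ : ℕ} (hσ : 0 < σ) {g₁ g₂ : SU d} (h₁ : IsGeneric g₁)
    (h₂ : IsGeneric g₂) (h₁₂ : IsGeneric (g₁ * g₂)) (m n : Fin d → ℕ) :
    HasSum (fun k : Fin d → ℕ =>
        (-1 : ℂ) ^ mdeg k * mpow (p g₁) k * mpow (pt g₂) k
          * wt σ k * M σ (U g₁) m k * M σ (U g₂) k n)
      ((a g₁ * a g₂ / a (g₁ * g₂)) ^ σ
        * mpow (pt (g₁ * g₂)) m * (mpow (pt g₁) m)⁻¹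
        * mpow (p (g₁ * g₂)) n * (mpow (p g₂) n)⁻¹
        * M σ (U (g₁ * g₂)) m n) := by
  have ha : ∀ g : SU d, (a g)⁻¹ ^ σ ≠ 0 := fun g => pow_ne_zero _ (inv_ne_zero (a_ne_zero g))
  have hp₂ : mpow (p g₂) n ≠ 0 := mpow_ne_zero (fun i => div_ne_zero (h₂.2 i).1 h₂.1) n
  have hpt₁ : mpow (pt g₁) m ≠ 0 := mpow_ne_zero (fun i => div_ne_zero (h₁.2 i).2 h₁.1) m
  have hs : (-1 : ℂ) ^ mdeg m ≠ 0 := pow_ne_zero _ (by norm_num)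
  have hw := wt_ne_zero hσ m
  have hK : (a g₁)⁻¹ ^ σ * (wt σ m * (-1) ^ mdeg m * mpow (pt g₁) m)
      * ((a g₂)⁻¹ ^ σ * mpow (p g₂) n) ≠ 0 :=
    mul_ne_zero (mul_ne_zero (ha _) (mul_ne_zero (mul_ne_zero hw hs) hpt₁))
      (mul_ne_zero (ha _) hp₂)
  have h := (hasSum_matCoeff_SU σ g₁ g₂ m n).mul_left
    ((a g₁)⁻¹ ^ σ * (wt σ m * (-1) ^ mdeg m * mpow (pt g₁) m)
      * ((a g₂)⁻¹ ^ σ * mpow (p g₂) n))⁻¹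
  convert! h using 1
  · funext k
    rw [eq_inv_mul_iff_mul_eq₀ hK, matCoeff_generic hσ h₁, matCoeff_generic hσ h₂]
    ring
  · rw [eq_inv_mul_iff_mul_eq₀ hK, matCoeff_generic hσ h₁₂, div_eq_mul_inv, mul_pow, mul_pow]
    have e₁ : (a g₁)⁻¹ ^ σ * (a g₁) ^ σ = 1 := by
      rw [← mul_pow, inv_mul_cancel₀ h₁.1, one_pow]
    have e₂ : (a g₂)⁻¹ ^ σ * (a g₂) ^ σ = 1 := by
      rw [← mul_pow, inv_mul_cancel₀ h₂.1, one_pow]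
    generalize (a g₁)⁻¹ ^ σ = x at *
    generalize (a g₂)⁻¹ ^ σ = y at *
    rw [eq_inv_of_mul_eq_one_right e₁, eq_inv_of_mul_eq_one_right e₂]
    have := left_ne_zero_of_mul_eq_one e₁
    have := left_ne_zero_of_mul_eq_one e₂
    field_simp

end MeixnerCoefficients

/-! ### Moments of the unit ball -/

section Moments

variable {d : ℕ}

/-- The truncated power `x₊^k`, equal to `0` for `x ≤ 0` (also when `k = 0`). -/
def posPow (k : ℕ) (x : ℝ) : ENNReal :=
  (Set.Ioi (0 : ℝ)).indicator (fun x => ENNReal.ofReal (x ^ k)) x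

theorem measurable_posPow (k : ℕ) : Measurable (posPow k) :=
  Measurable.indicator (by fun_prop) measurableSet_Ioi

theorem posPow_mul (k : ℕ) {x y : ℝ} (hx : 0 < x) :
    posPow k (x * y) = ENNReal.ofReal (x ^ k) * posPow k y := by
  by_cases hy : 0 < y
  · have hxy : 0 < x * y := mul_pos hx hy
    simp only [posPow, Set.indicator, Set.mem_Ioi, hy, hxy, if_true]
    rw [mul_pow, ENNReal.ofReal_mul (by positivity)]
  · have hxy : ¬ 0 < x * y := fun h => hy (pos_of_mul_pos_right h hx.le)
    simp [posPow, Set.indicator, hy, hxy]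

theorem lintegral_exp_neg_mul_posPow (k : ℕ) :
    ∫⁻ x, ENNReal.ofReal (Real.exp (-x)) * posPow k x = ENNReal.ofReal (k.factorial : ℝ) := by
  have h1 : (fun x : ℝ => ENNReal.ofReal (Real.exp (-x)) * posPow k x)
      = (Set.Ioi (0 : ℝ)).indicator fun x => ENNReal.ofReal (Real.exp (-x) * x ^ k) := by
    funext x
    by_cases hx : 0 < x
    · simp [posPow, Set.indicator, hx, ENNReal.ofReal_mul (Real.exp_pos _).le]
    · simp [posPow, Set.indicator, hx]
  have hk : (0 : ℝ) < k + 1 := by positivity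
  have h2 : ∀ x : ℝ, x ^ ((k : ℝ) + 1 - 1) = x ^ k := fun x => by
    rw [add_sub_cancel_right, Real.rpow_natCast]
  have h3 := Real.GammaIntegral_convergent hk
  have h4 := Real.Gamma_eq_integral hk
  simp only [h2] at h3 h4
  rw [h1, lintegral_indicator measurableSet_Ioi, ← ofReal_integral_eq_lintegral_ofReal h3, ← h4,
    Real.Gamma_nat_eq_factorial]
  filter_upwards [ae_restrict_mem measurableSet_Ioi] with x hx
  have : (0 : ℝ) < x := hx
  simp only [Pi.zero_apply]
  positivity

theorem lintegral_exp_neg_mul_posPow_sub (k : ℕ) (y : ℝ) :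
    ∫⁻ x, ENNReal.ofReal (Real.exp (-x)) * posPow k (x - y)
      = ENNReal.ofReal (Real.exp (-y)) * ENNReal.ofReal (k.factorial : ℝ) := by
  have h := lintegral_sub_right_eq_self (μ := (volume : Measure ℝ))
    (fun x => ENNReal.ofReal (Real.exp (-(x + y))) * posPow k x) y
  simp only [sub_add_cancel] at h
  rw [h, ← lintegral_exp_neg_mul_posPow, ← lintegral_const_mul]
  · refine lintegral_congr fun x => ?_
    rw [← mul_assoc, ← ENNReal.ofReal_mul (Real.exp_pos _).le, ← Real.exp_add, neg_add, add_comm]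
  · exact Measurable.mul (by fun_prop) (measurable_posPow k)

/-- The Gaussian moments `∫ |z^m|² exp(-‖z‖²) = π^d m!`. -/
theorem lintegral_gaussian (m : Fin d → ℕ) :
    ∫⁻ z : Fin d → ℂ, ENNReal.ofReal ((∏ i, ‖z i‖ ^ (2 * m i)) * Real.exp (-∑ i, ‖z i‖ ^ 2))
      = ENNReal.ofReal (Real.pi ^ d * (mfact m : ℝ)) := by
  have h1 : ∀ k : ℕ, ∫ x : ℂ, ‖x‖ ^ (2 * k) * Real.exp (-‖x‖ ^ 2)
      = Real.pi * (k.factorial : ℝ) := fun k => by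
    have h := Complex.integral_rpow_mul_exp_neg_rpow (p := 2) (q := (2 * k : ℕ)) (by norm_num)
      (by have : (0 : ℝ) ≤ (2 * k : ℕ) := Nat.cast_nonneg _
          linarith)
    have e : (((2 * k : ℕ) : ℝ) + 2) / 2 = k + 1 := by push_cast; ring
    rw [e, Real.Gamma_nat_eq_factorial] at h
    have e2 : ∀ x : ℂ, ‖x‖ ^ (2 : ℝ) = ‖x‖ ^ 2 := fun x => by
      exact_mod_cast Real.rpow_natCast ‖x‖ 2
    simp only [Real.rpow_natCast, e2] at h
    rw [h]
    ring
  have h2 : (fun z : Fin d → ℂ => (∏ i, ‖z i‖ ^ (2 * m i)) * Real.exp (-∑ i, ‖z i‖ ^ 2))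
      = fun z => ∏ i, (‖z i‖ ^ (2 * m i) * Real.exp (-‖z i‖ ^ 2)) := by
    funext z
    rw [Finset.prod_mul_distrib, ← Real.exp_sum, Finset.sum_neg_distrib]
  have h3 : ∫ z : Fin d → ℂ, ((∏ i, ‖z i‖ ^ (2 * m i)) * Real.exp (-∑ i, ‖z i‖ ^ 2))
      = Real.pi ^ d * (mfact m : ℝ) := by
    rw [h2, integral_fintype_prod_volume_eq_prod fun i (x : ℂ) =>
      ‖x‖ ^ (2 * m i) * Real.exp (-‖x‖ ^ 2)]
    simp only [h1, Finset.prod_mul_distrib, Finset.prod_const, Finset.card_univ, Fintype.card_fin,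
      mfact, Nat.cast_prod]
  -- A function with nonzero Bochner integral is integrable.
  have h4 : Integrable fun z : Fin d → ℂ =>
      (∏ i, ‖z i‖ ^ (2 * m i)) * Real.exp (-∑ i, ‖z i‖ ^ 2) := by
    by_contra h
    rw [integral_undef h] at h3
    have : (0 : ℝ) < Real.pi ^ d * (mfact m : ℝ) := by
      have : 0 < mfact m := Finset.prod_pos fun i _ => Nat.factorial_pos _
      positivity
    exact this.ne h3
  rw [← ofReal_integral_eq_lintegral_ofReal h4 (Eventually.of_forall fun z => by
    simp only [Pi.zero_apply]; positivity), h3]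

/-- `∫ |z^m|² (x - ‖z‖²)₊^s` over `ℂ^d`. -/
def ballMoment (m : Fin d → ℕ) (s : ℕ) (x : ℝ) : ENNReal :=
  ∫⁻ z : Fin d → ℂ, ENNReal.ofReal (∏ i, ‖z i‖ ^ (2 * m i)) * posPow s (x - ∑ i, ‖z i‖ ^ 2)

theorem measurable_ballMoment_integrand (m : Fin d → ℕ) (s : ℕ) :
    Measurable fun q : ℝ × (Fin d → ℂ) =>
      ENNReal.ofReal (∏ i, ‖q.2 i‖ ^ (2 * m i)) * posPow s (q.1 - ∑ i, ‖q.2 i‖ ^ 2) := by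
  refine Measurable.mul (by fun_prop) ((measurable_posPow s).comp ?_)
  fun_prop

theorem ballMoment_scaling (m : Fin d → ℕ) (s : ℕ) (x : ℝ) :
    ballMoment m s x = posPow (d + mdeg m + s) x * ballMoment m s 1 := by
  have hR : ∀ z : Fin d → ℂ, 0 ≤ ∑ i, ‖z i‖ ^ 2 := fun z =>
    Finset.sum_nonneg fun _ _ => by positivity
  by_cases hx : 0 < x
  · have hsq : Real.sqrt x ≠ 0 := (Real.sqrt_pos.mpr hx).ne'
    have hm := (measurable_ballMoment_integrand m s).comp
      (measurable_prodMk_left (x := x) : Measurable fun z : Fin d → ℂ => (x, z))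
    have h1 := lintegral_map (μ := (volume : Measure (Fin d → ℂ))) hm
      (measurable_const_smul (Real.sqrt x))
    rw [Measure.map_addHaar_smul volume hsq, lintegral_smul_measure] at h1
    have hfin : Module.finrank ℝ (Fin d → ℂ) = 2 * d := by
      rw [Module.finrank_pi_fintype]
      simp [Complex.finrank_real_complex, mul_comm]
    have hpow : |(Real.sqrt x ^ Module.finrank ℝ (Fin d → ℂ))⁻¹| = (x ^ d)⁻¹ := by
      rw [hfin, pow_mul, Real.sq_sqrt hx.le, abs_of_pos (by positivity)]
    rw [hpow] at h1
    have h2 : ∀ z : Fin d → ℂ,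
        ENNReal.ofReal (∏ i, ‖(Real.sqrt x • z) i‖ ^ (2 * m i))
          * posPow s (x - ∑ i, ‖(Real.sqrt x • z) i‖ ^ 2)
        = ENNReal.ofReal (x ^ (mdeg m + s)) * (ENNReal.ofReal (∏ i, ‖z i‖ ^ (2 * m i))
          * posPow s (1 - ∑ i, ‖z i‖ ^ 2)) := fun z => by
      have e1 : ∀ i, ‖(Real.sqrt x • z) i‖ ^ 2 = x * ‖z i‖ ^ 2 := fun i => by
        rw [Pi.smul_apply, norm_smul, Real.norm_of_nonneg (Real.sqrt_nonneg x), mul_pow,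
          Real.sq_sqrt hx.le]
      have e2 : x - ∑ i, x * ‖z i‖ ^ 2 = x * (1 - ∑ i, ‖z i‖ ^ 2) := by
        rw [mul_sub, mul_one, Finset.mul_sum]
      simp only [pow_mul, e1]
      rw [e2, posPow_mul s hx]
      simp only [mul_pow, Finset.prod_mul_distrib, Finset.prod_pow_eq_pow_sum]
      rw [ENNReal.ofReal_mul (by positivity), pow_add, ENNReal.ofReal_mul (by positivity), mdeg]
      ring
    simp only [Function.comp_def, h2] at h1
    rw [lintegral_const_mul' _ _ ENNReal.ofReal_ne_top] at h1
    have h3 : ENNReal.ofReal ((x ^ d)⁻¹) * ballMoment m s x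
        = ENNReal.ofReal (x ^ (mdeg m + s)) * ballMoment m s 1 := h1
    have h4 : ENNReal.ofReal (x ^ d) * ENNReal.ofReal ((x ^ d)⁻¹) = 1 := by
      rw [← ENNReal.ofReal_mul (by positivity), mul_inv_cancel₀ (by positivity), ENNReal.ofReal_one]
    have h5 : posPow (d + mdeg m + s) x
        = ENNReal.ofReal (x ^ d) * ENNReal.ofReal (x ^ (mdeg m + s)) := by
      rw [← ENNReal.ofReal_mul (by positivity), ← pow_add, ← add_assoc]
      simp [posPow, Set.indicator, hx]
    rw [h5, mul_assoc, ← h3, ← mul_assoc, h4, one_mul]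
  · have h1 : ∀ z : Fin d → ℂ, posPow s (x - ∑ i, ‖z i‖ ^ 2) = 0 := fun z => by
      have : ¬ 0 < x - ∑ i, ‖z i‖ ^ 2 := by linarith [hR z]
      simp only [posPow, Set.indicator, Set.mem_Ioi, this, if_false]
    have h2 : posPow (d + mdeg m + s) x = 0 := by simp [posPow, Set.indicator, hx]
    simp [ballMoment, h1, h2]

/-- The Laplace transform in `x` of `ballMoment m s x` is computed twice: by homogeneity, and by
integrating over `x` first, which leaves a Gaussian moment. -/
theorem ballMoment_one (m : Fin d → ℕ) (s : ℕ) :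
    ballMoment m s 1 = ENNReal.ofReal
      (Real.pi ^ d * mfact m * s.factorial / ((d + mdeg m + s).factorial : ℝ)) := by
  have h1 : ∫⁻ x, ENNReal.ofReal (Real.exp (-x)) * ballMoment m s x
      = ENNReal.ofReal ((d + mdeg m + s).factorial : ℝ) * ballMoment m s 1 := by
    rw [← lintegral_exp_neg_mul_posPow, ← lintegral_mul_const]
    · refine lintegral_congr fun x => ?_
      rw [ballMoment_scaling, mul_assoc]
    · exact Measurable.mul (by fun_prop) (measurable_posPow _)
  have h2 : ∫⁻ x, ENNReal.ofReal (Real.exp (-x)) * ballMoment m s x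
      = ENNReal.ofReal (Real.pi ^ d * mfact m) * ENNReal.ofReal (s.factorial : ℝ) := by
    have e1 : ∀ x, ENNReal.ofReal (Real.exp (-x)) * ballMoment m s x
        = ∫⁻ z : Fin d → ℂ, ENNReal.ofReal (Real.exp (-x)) *
          (ENNReal.ofReal (∏ i, ‖z i‖ ^ (2 * m i)) * posPow s (x - ∑ i, ‖z i‖ ^ 2)) := fun x => by
      rw [lintegral_const_mul' _ _ ENNReal.ofReal_ne_top]
      rfl
    simp only [e1]
    rw [lintegral_lintegral_swap]
    · rw [← lintegral_gaussian, ← lintegral_mul_const _ (by fun_prop)]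
      refine lintegral_congr fun z => ?_
      have e2 : ∀ x, ENNReal.ofReal (Real.exp (-x)) *
          (ENNReal.ofReal (∏ i, ‖z i‖ ^ (2 * m i)) * posPow s (x - ∑ i, ‖z i‖ ^ 2))
          = ENNReal.ofReal (∏ i, ‖z i‖ ^ (2 * m i)) *
            (ENNReal.ofReal (Real.exp (-x)) * posPow s (x - ∑ i, ‖z i‖ ^ 2)) := fun x => by ring
      simp only [e2]
      rw [lintegral_const_mul', lintegral_exp_neg_mul_posPow_sub, ← mul_assoc,
        ← ENNReal.ofReal_mul (by positivity)]
      exact ENNReal.ofReal_ne_top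
    · exact (Measurable.mul (by fun_prop) (measurable_ballMoment_integrand m s)).aemeasurable
  have h3 : (0 : ℝ) < ((d + mdeg m + s).factorial : ℝ) := by exact_mod_cast Nat.factorial_pos _
  rw [h1, ← ENNReal.ofReal_mul (by positivity)] at h2
  rw [ENNReal.ofReal_div_of_pos h3, ← h2, mul_comm, ENNReal.mul_div_cancel_right]
  · exact (ENNReal.ofReal_pos.mpr h3).ne'
  · exact ENNReal.ofReal_ne_top

theorem isOpen_unitBall : IsOpen (unitBall d) :=
  isOpen_lt (by fun_prop) continuous_const

theorem measurableSet_unitBall : MeasurableSet (unitBall d) := isOpen_unitBall.measurableSet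

theorem setLIntegral_unitBall (m : Fin d → ℕ) (s : ℕ) :
    ∫⁻ z in unitBall d, ENNReal.ofReal ((∏ i, ‖z i‖ ^ (2 * m i)) * (1 - ∑ i, ‖z i‖ ^ 2) ^ s)
      = ENNReal.ofReal
        (Real.pi ^ d * mfact m * s.factorial / ((d + mdeg m + s).factorial : ℝ)) := by
  rw [← ballMoment_one, ballMoment, ← lintegral_indicator measurableSet_unitBall]
  refine lintegral_congr fun z => ?_
  by_cases hz : z ∈ unitBall d
  · have h1 : 0 < 1 - ∑ i, ‖z i‖ ^ 2 := sub_pos.mpr hz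
    rw [Set.indicator_of_mem hz, ENNReal.ofReal_mul (by positivity)]
    simp only [posPow, Set.indicator, Set.mem_Ioi, h1, if_true]
  · have h1 : ¬ 0 < 1 - ∑ i, ‖z i‖ ^ 2 := fun h => hz (sub_pos.mp h)
    rw [Set.indicator_of_notMem hz]
    simp only [posPow, Set.indicator, Set.mem_Ioi, h1, if_false, mul_zero]

theorem volume_unitBall :
    volume (unitBall d) = ENNReal.ofReal (Real.pi ^ d / (d.factorial : ℝ)) := by
  have h := setLIntegral_unitBall (0 : Fin d → ℕ) 0
  simpa [mfact, mdeg] using h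

/-- The squared norm of `z^m` for the unnormalized weighted measure on the ball. -/
theorem setIntegral_unitBall (m : Fin d → ℕ) (s : ℕ) :
    ∫ z in unitBall d, mpow z m * mpow (fun i => conj (z i)) m
        * ((1 - ∑ i, ‖z i‖ ^ 2 : ℝ) : ℂ) ^ s
      = ((Real.pi ^ d * mfact m * s.factorial / ((d + mdeg m + s).factorial : ℝ) : ℝ) : ℂ) := by
  have h1 : ∀ z : Fin d → ℂ, mpow z m * mpow (fun i => conj (z i)) m
        * ((1 - ∑ i, ‖z i‖ ^ 2 : ℝ) : ℂ) ^ s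
      = (((∏ i, ‖z i‖ ^ (2 * m i)) * (1 - ∑ i, ‖z i‖ ^ 2) ^ s : ℝ) : ℂ) := fun z => by
    rw [mpow_conj, Complex.mul_conj', norm_mpow]
    push_cast
    rw [← Finset.prod_pow]
    simp only [← pow_mul, mul_comm]
  simp only [h1]
  rw [integral_complex_ofReal, integral_eq_lintegral_of_nonneg_ae, setLIntegral_unitBall,
    ENNReal.toReal_ofReal (by positivity)]
  · filter_upwards [ae_restrict_mem measurableSet_unitBall] with z hz
    have h1 : 0 < 1 - ∑ i, ‖z i‖ ^ 2 := sub_pos.mpr hz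
    simp only [Pi.zero_apply]
    positivity
  · exact Continuous.aestronglyMeasurable (by fun_prop)

/-- Different monomials are orthogonal: rotate a coordinate in which the exponents differ by an
angle for which the integrand changes sign. -/
theorem setIntegral_unitBall_eq_zero {k m : Fin d → ℕ} (hkm : k ≠ m) (s : ℕ) :
    ∫ z in unitBall d, mpow z k * mpow (fun i => conj (z i)) m
        * ((1 - ∑ i, ‖z i‖ ^ 2 : ℝ) : ℂ) ^ s = 0 := by
  obtain ⟨i, hi⟩ := Function.ne_iff.mp hkm
  have hδ : ((k i : ℂ) - m i) ≠ 0 := sub_ne_zero.mpr (by exact_mod_cast hi)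
  let θ : ℝ := Real.pi / ((k i : ℝ) - m i)
  let ω : Fin d → Circle := Pi.mulSingle i (Circle.exp θ)
  have hω : mpow (fun j => (ω j : ℂ)) k * mpow (fun j => conj (ω j : ℂ)) m = -1 := by
    have e : ∀ (n : Fin d → ℕ) (x : ℂ → ℂ), x 1 = 1 →
        mpow (fun j => x (ω j : ℂ)) n = x (Circle.exp θ : ℂ) ^ n i := fun n x hx => by
      rw [mpow, Finset.prod_eq_single i]
      · simp [ω]
      · intro j _ hj; simp [ω, hj, hx]
      · simp
    rw [e k (fun z => z) rfl, e m conj (map_one _), Circle.coe_exp, ← Complex.exp_conj,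
      ← Complex.exp_nat_mul, ← Complex.exp_nat_mul, ← Complex.exp_add, ← Complex.exp_pi_mul_I]
    congr 1
    simp only [θ, map_mul, Complex.conj_ofReal, Complex.conj_I]
    push_cast
    field_simp
    ring
  let T : (Fin d → ℂ) → (Fin d → ℂ) := fun z j => (ω j : ℂ) * z j
  have hT : MeasurePreserving T := by
    refine volume_preserving_pi (f := fun j (x : ℂ) => (ω j : ℂ) * x) fun j => ?_
    exact (rotation (ω j)).measurePreserving
  let F : (Fin d → ℂ) → ℂ := (unitBall d).indicator fun z =>
    mpow z k * mpow (fun i => conj (z i)) m * ((1 - ∑ i, ‖z i‖ ^ 2 : ℝ) : ℂ) ^ s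
  have hF : AEStronglyMeasurable F (Measure.map T volume) := by
    refine AEStronglyMeasurable.indicator (Continuous.aestronglyMeasurable ?_)
      measurableSet_unitBall
    unfold mpow
    fun_prop
  have h1 := integral_map hT.measurable.aemeasurable hF
  rw [hT.map_eq] at h1
  have h2 : ∀ z, F (T z) = -F z := fun z => by
    have hn : ∀ j, ‖T z j‖ = ‖z j‖ := fun j => by
      simp only [T]
      rw [norm_mul, Circle.norm_coe, one_mul]
    have hmem : T z ∈ unitBall d ↔ z ∈ unitBall d := by simp [unitBall, hn]
    by_cases hz : z ∈ unitBall d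
    · simp only [F]
      rw [Set.indicator_of_mem hz, Set.indicator_of_mem (hmem.mpr hz)]
      simp only [hn]
      have e1 : mpow (T z) k = mpow (fun j => (ω j : ℂ)) k * mpow z k := mpow_mul _ _ _
      have e2 : mpow (fun j => conj (T z j)) m
          = mpow (fun j => conj (ω j : ℂ)) m * mpow (fun j => conj (z j)) m := by
        rw [← mpow_mul]
        simp only [T, map_mul]
      rw [e1, e2]
      linear_combination (mpow z k * mpow (fun j => conj (z j)) m
        * ((1 - ∑ i, ‖z i‖ ^ 2 : ℝ) : ℂ) ^ s) * hω
    · simp only [F]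
      rw [Set.indicator_of_notMem hz, Set.indicator_of_notMem fun h => hz (hmem.mp h), neg_zero]
  simp only [h2, integral_neg] at h1
  rw [← integral_indicator measurableSet_unitBall]
  exact self_eq_neg.mp h1

end Moments

/-! ### Matrix coefficients as integrals over the ball -/

section BallIntegral

variable {d : ℕ}

theorem norm_le_one_of_mem_unitBall {z : Fin d → ℂ} (hz : z ∈ unitBall d) (i : Fin d) :
    ‖z i‖ ≤ 1 := by
  have h1 : ‖z i‖ ^ 2 ≤ ∑ j, ‖z j‖ ^ 2 :=
    Finset.single_le_sum (f := fun j => ‖z j‖ ^ 2) (fun _ _ => by positivity) (Finset.mem_univ i)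
  have h2 : ∑ j, ‖z j‖ ^ 2 < 1 := hz
  exact (sq_le_one_iff₀ (norm_nonneg _)).mp (h1.trans h2.le)

/-- For `g` in `SU(1,d)` the expansion of the image of `z^n` converges on the whole ball, with
absolute sums that are bounded uniformly on the ball. -/
theorem exists_bound_unitBall (σ : ℕ) (g : SU d) (n : Fin d → ℕ) :
    ∃ C : ℝ, ∀ z ∈ unitBall d,
      HasSum (fun k => matCoeff σ g.1.1 k n * mpow z k) (monomialImage σ g.1.1 n z) ∧
      ∑' k, ‖matCoeff σ g.1.1 k n * mpow z k‖ ≤ C := by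
  have hS : Real.sqrt (∑ j, ‖c g j‖ ^ 2) < ‖a g‖ := by
    rw [Real.sqrt_lt' (norm_pos_iff.mpr (a_ne_zero g)), sum_norm_c_sq]
    linarith
  -- The polyradii `‖z_j‖ + δ` are positive, and the slack `A` does not depend on `z`.
  obtain ⟨δ, hδ, hδ0⟩ : ∃ δ : ℝ,
      Real.sqrt (∑ j, ‖c g j‖ ^ 2) + δ * ∑ j, ‖c g j‖ < ‖a g‖ ∧ 0 < δ := by
    have h1 : ∀ᶠ δ in 𝓝[>] (0 : ℝ),
        Real.sqrt (∑ j, ‖c g j‖ ^ 2) + δ * ∑ j, ‖c g j‖ < ‖a g‖ := by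
      have : Continuous fun δ : ℝ => Real.sqrt (∑ j, ‖c g j‖ ^ 2) + δ * ∑ j, ‖c g j‖ := by
        fun_prop
      refine (this.continuousAt.eventually_lt continuousAt_const ?_).filter_mono nhdsWithin_le_nhds
      simpa using hS
    exact (h1.and self_mem_nhdsWithin).exists
  let A : ℝ := ‖a g‖ - (Real.sqrt (∑ j, ‖c g j‖ ^ 2) + δ * ∑ j, ‖c g j‖)
  have hA0 : 0 < A := sub_pos.mpr hδ
  let ρ : Fin d → ℝ := fun i =>
    (‖g.1.1 0 i.succ‖ + ∑ j : Fin d, (1 + δ) * ‖g.1.1 j.succ i.succ‖) / A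
  refine ⟨A⁻¹ ^ σ * ∏ i, ρ i ^ n i, fun z hz => ?_⟩
  have hr : ∀ i, 0 < (fun i => ‖z i‖ + δ) i := fun i => by positivity
  have hle : ∀ i, ‖z i‖ ≤ (fun i => ‖z i‖ + δ) i := fun i => by simp [hδ0.le]
  have hA : A + ∑ j, (‖z j‖ + δ) * ‖g.1.1 j.succ 0‖ ≤ ‖g.1.1 0 0‖ := by
    have h1 := Real.sum_mul_le_sqrt_mul_sqrt Finset.univ (fun j => ‖z j‖) fun j => ‖c g j‖
    have h2 : Real.sqrt (∑ j, ‖z j‖ ^ 2) ≤ 1 := Real.sqrt_le_one.mpr (le_of_lt hz)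
    have h3 : Real.sqrt (∑ j, ‖z j‖ ^ 2) * Real.sqrt (∑ j, ‖c g j‖ ^ 2)
        ≤ Real.sqrt (∑ j, ‖c g j‖ ^ 2) := mul_le_of_le_one_left (Real.sqrt_nonneg _) h2
    simp only [add_mul, Finset.sum_add_distrib]
    rw [← Finset.mul_sum]
    simp only [A, a, c] at h1 h3 ⊢
    linarith
  have hρ : ∀ i : Fin d, ‖g.1.1 0 i.succ‖ + ∑ j, (‖z j‖ + δ) * ‖g.1.1 j.succ i.succ‖
      ≤ A * ρ i := fun i => by
    simp only [ρ]
    rw [mul_div_cancel₀ _ hA0.ne']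
    gcongr with j
    exact norm_le_one_of_mem_unitBall hz j
  have h := expands_monomialImage σ hr hA0 hA hρ n
  refine ⟨h.hasSum z hle, le_trans ?_ h.tsum_le⟩
  have hmaj : ∀ k, ‖matCoeff σ g.1.1 k n * mpow z k‖
      ≤ ‖matCoeff σ g.1.1 k n‖ * ∏ i, (‖z i‖ + δ) ^ k i := fun k => by
    rw [norm_mul]
    exact mul_le_mul_of_nonneg_left (norm_mpow_le hle k) (norm_nonneg _)
  exact (h.hasSum z hle).summable.norm.tsum_le_tsum hmaj h.summable

theorem continuous_ballTerm (k m : Fin d → ℕ) (s : ℕ) (x : ℂ) :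
    Continuous fun z : Fin d → ℂ => x * mpow z k * mpow (fun i => conj (z i)) m
      * ((1 - ∑ i, ‖z i‖ ^ 2 : ℝ) : ℂ) ^ s := by
  unfold mpow
  fun_prop

theorem norm_ballWeight_le {z : Fin d → ℂ} (hz : z ∈ unitBall d) (m : Fin d → ℕ) (s : ℕ) (x : ℂ) :
    ‖x * mpow (fun i => conj (z i)) m * ((1 - ∑ i, ‖z i‖ ^ 2 : ℝ) : ℂ) ^ s‖ ≤ ‖x‖ := by
  have h1 : ‖mpow (fun i => conj (z i)) m‖ ≤ 1 := by
    rw [norm_mpow]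
    refine Finset.prod_le_one (fun _ _ => by positivity) fun i _ => pow_le_one₀ (norm_nonneg _) ?_
    rw [Complex.norm_conj]
    exact norm_le_one_of_mem_unitBall hz i
  have h2 : ‖((1 - ∑ i, ‖z i‖ ^ 2 : ℝ) : ℂ) ^ s‖ ≤ 1 := by
    have h3 : 0 ≤ 1 - ∑ i, ‖z i‖ ^ 2 := (sub_pos.mpr hz).le
    have h4 : 0 ≤ ∑ i, ‖z i‖ ^ 2 := Finset.sum_nonneg fun _ _ => by positivity
    rw [norm_pow, Complex.norm_real, Real.norm_of_nonneg h3]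
    exact pow_le_one₀ h3 (by linarith)
  rw [norm_mul, norm_mul]
  calc _ ≤ ‖x‖ * 1 * 1 := by gcongr
    _ = ‖x‖ := by ring

theorem volume_unitBall_lt_top : volume (unitBall d) < ⊤ := by
  rw [volume_unitBall]
  exact ENNReal.ofReal_lt_top

/-- Integrating the expansion term by term against `conj z^m (1 - ‖z‖²)^s` leaves the coefficient
of `z^m`. -/
theorem setIntegral_monomialImage (σ : ℕ) (g : SU d) (m n : Fin d → ℕ) (s : ℕ) :
    IntegrableOn (fun z => monomialImage σ g.1.1 n z * mpow (fun i => conj (z i)) m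
        * ((1 - ∑ i, ‖z i‖ ^ 2 : ℝ) : ℂ) ^ s) (unitBall d) ∧
    ∫ z in unitBall d, monomialImage σ g.1.1 n z * mpow (fun i => conj (z i)) m
        * ((1 - ∑ i, ‖z i‖ ^ 2 : ℝ) : ℂ) ^ s
      = matCoeff σ g.1.1 m n * ((Real.pi ^ d * mfact m * s.factorial
        / ((d + mdeg m + s).factorial : ℝ) : ℝ) : ℂ) := by
  obtain ⟨C, hC⟩ := exists_bound_unitBall σ g n
  let f : (Fin d → ℕ) → (Fin d → ℂ) → ℂ := fun k z => matCoeff σ g.1.1 k n * mpow z k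
    * mpow (fun i => conj (z i)) m * ((1 - ∑ i, ‖z i‖ ^ 2 : ℝ) : ℂ) ^ s
  have hfm : ∀ k, AEStronglyMeasurable (f k) (volume.restrict (unitBall d)) := fun k =>
    (continuous_ballTerm k m s _).aestronglyMeasurable
  have hsum : ∀ z ∈ unitBall d, HasSum (fun k => f k z)
      (monomialImage σ g.1.1 n z * mpow (fun i => conj (z i)) m
        * ((1 - ∑ i, ‖z i‖ ^ 2 : ℝ) : ℂ) ^ s) := fun z hz =>
    ((hC z hz).1.mul_right _).mul_right _
  have hnorm : ∀ z ∈ unitBall d, ∑' k, ‖f k z‖ ≤ C := fun z hz => by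
    refine le_trans ?_ (hC z hz).2
    exact (hsum z hz).summable.norm.tsum_le_tsum (fun k => norm_ballWeight_le hz m s _)
      (hC z hz).1.summable.norm
  have hmeas : AEStronglyMeasurable (fun z => monomialImage σ g.1.1 n z
      * mpow (fun i => conj (z i)) m * ((1 - ∑ i, ‖z i‖ ^ 2 : ℝ) : ℂ) ^ s)
      volume := by
    refine Measurable.aestronglyMeasurable ?_
    unfold monomialImage proj aff mpow
    fun_prop
  have hbound : ∀ᵐ z ∂(volume.restrict (unitBall d)), ‖monomialImage σ g.1.1 n z
      * mpow (fun i => conj (z i)) m * ((1 - ∑ i, ‖z i‖ ^ 2 : ℝ) : ℂ) ^ s‖ ≤ C := by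
    filter_upwards [ae_restrict_mem measurableSet_unitBall] with z hz
    rw [← (hsum z hz).tsum_eq]
    exact (norm_tsum_le_tsum_norm (hsum z hz).summable.norm).trans (hnorm z hz)
  refine ⟨Measure.integrableOn_of_bounded volume_unitBall_lt_top.ne hmeas hbound, ?_⟩
  have hfin : ∑' k, ∫⁻ z in unitBall d, ‖f k z‖ₑ ≠ ⊤ := by
    rw [← lintegral_tsum fun k => (hfm k).enorm]
    have h1 : ∫⁻ z in unitBall d, ∑' k, ‖f k z‖ₑ ≤ ∫⁻ _ in unitBall d, ENNReal.ofReal C := by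
      refine setLIntegral_mono' measurableSet_unitBall fun z hz => ?_
      simp only [← ofReal_norm]
      rw [← ENNReal.ofReal_tsum_of_nonneg (fun _ => norm_nonneg _) (hsum z hz).summable.norm]
      exact ENNReal.ofReal_le_ofReal (hnorm z hz)
    refine (h1.trans_lt ?_).ne
    rw [lintegral_const, Measure.restrict_apply_univ]
    exact ENNReal.mul_lt_top ENNReal.ofReal_lt_top volume_unitBall_lt_top
  have h2 := integral_tsum hfm hfin
  have h3 : ∫ z in unitBall d, monomialImage σ g.1.1 n z * mpow (fun i => conj (z i)) m
        * ((1 - ∑ i, ‖z i‖ ^ 2 : ℝ) : ℂ) ^ s = ∫ z in unitBall d, ∑' k, f k z :=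
    setIntegral_congr_fun measurableSet_unitBall fun z hz => (hsum z hz).tsum_eq.symm
  have h4 : ∀ k, ∫ z in unitBall d, f k z = matCoeff σ g.1.1 k n *
      ∫ z in unitBall d, mpow z k * mpow (fun i => conj (z i)) m
        * ((1 - ∑ i, ‖z i‖ ^ 2 : ℝ) : ℂ) ^ s := fun k => by
    rw [← integral_const_mul]
    simp only [f, mul_assoc]
  rw [h3, h2, tsum_eq_single m, h4, setIntegral_unitBall]
  intro k hk
  rw [h4, setIntegral_unitBall_eq_zero hk, mul_zero]

/-- The normalizing constant of the integral formula cancels the moment `‖z^m‖²`. -/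
theorem moment_normalization (m : Fin d → ℕ) (s : ℕ) :
    poch (((d + 1 + s : ℕ) : ℂ) - d) d * wt (d + 1 + s) m * (mfact m * s.factorial)
      = ((d + mdeg m + s).factorial : ℂ) := by
  have e1 : ((d + 1 + s : ℕ) : ℂ) - d = ((s + 1 : ℕ) : ℂ) := by push_cast; ring
  rw [e1, wt, poch_natCast, poch_natCast]
  have h1 := Nat.factorial_mul_ascFactorial s d
  have h2 := Nat.factorial_mul_ascFactorial (s + d) (mdeg m)
  have e2 : d + 1 + s = s + d + 1 := by ring
  have e3 : d + mdeg m + s = s + d + mdeg m := by ring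
  rw [e2, e3, ← h2, ← h1]
  have := mfact_ne_zero m
  push_cast
  field_simp

/-- Up to a constant factor, the holomorphic part of the integrand is the image of `z^n`. -/
theorem ballIntegrand_eq {s : ℕ} {g : SU d} (hg : IsGeneric g) (m n : Fin d → ℕ)
    (z : Fin d → ℂ) :
    ballIntegrand (d + 1 + s) g m n z = ((a g)⁻¹ ^ (d + 1 + s) * mpow (p g) n)⁻¹
      * (monomialImage (d + 1 + s) g.1.1 n z * mpow (fun i => conj (z i)) m
        * ((1 - ∑ i, ‖z i‖ ^ 2 : ℝ) : ℂ) ^ s) := by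
  have ha := hg.1
  have hb := fun i => (hg.2 i).1
  have hc := fun i => (hg.2 i).2
  have e1 : 1 + ∑ i, pt g i * z i = (a g)⁻¹ * aff g.1.1 z 0 := by
    rw [aff, mul_add, Finset.mul_sum]
    change _ = (a g)⁻¹ * a g + _
    rw [inv_mul_cancel₀ ha]
    congr 1
    refine Finset.sum_congr rfl fun j _ => ?_
    change c g j / a g * z j = (a g)⁻¹ * (z j * c g j)
    ring
  have e2 : ∀ i, 1 + ∑ j, U g i j * pt g j * z j = (b g i)⁻¹ * aff g.1.1 z i.succ := fun i => by
    rw [aff, mul_add, Finset.mul_sum]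
    change _ = (b g i)⁻¹ * b g i + _
    rw [inv_mul_cancel₀ (hb i)]
    congr 1
    refine Finset.sum_congr rfl fun j _ => ?_
    change a g * D g j i / (b g i * c g j) * (c g j / a g) * z j = (b g i)⁻¹ * (z j * D g j i)
    have := hb i
    have := hc j
    field_simp
  have e3 : (-((d + 1 + s : ℕ) : ℤ) - (mdeg n : ℤ)) = -((d + 1 + s + mdeg n : ℕ) : ℤ) := by
    push_cast; ring
  have e4 : (((d + 1 + s : ℕ) : ℤ) - (d : ℤ) - 1) = ((s : ℕ) : ℤ) := by push_cast; ring
  have e5 : mpow (p g) n = mpow (b g) n * ((a g) ^ mdeg n)⁻¹ := by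
    simp [p, mpow, mdeg, div_eq_mul_inv, mul_pow, Finset.prod_mul_distrib,
      Finset.prod_pow_eq_pow_sum]
  rw [ballIntegrand, e1, e3, e4, zpow_natCast, zpow_neg, zpow_natCast, monomialImage_eq, e5]
  simp only [e2, mul_pow, Finset.prod_mul_distrib]
  change _ * (mpow (fun i => (b g i)⁻¹) n * _) * _ * _ = _
  rw [mpow_inv, pow_add (a g)⁻¹, inv_pow, inv_pow, inv_pow, mul_inv, mul_inv, mul_inv, mul_inv,
    inv_inv, inv_inv]
  ring

/-- The integral formula, with `σ = d + 1 + s` so that the weight exponent `σ - d - 1` is the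
natural number `s`. -/
theorem meixner_eq_integral {s : ℕ} {g : SU d} (hg : IsGeneric g) (m n : Fin d → ℕ) :
    Integrable (ballIntegrand (d + 1 + s) g m n) (ballMeasure d) ∧
      (-1 : ℂ) ^ mdeg m * mpow (pt g) m * M (d + 1 + s) (U g) m n
        = poch (((d + 1 + s : ℕ) : ℂ) - (d : ℂ)) d / (d.factorial : ℂ)
          * ∫ z, ballIntegrand (d + 1 + s) g m n z ∂(ballMeasure d) := by
  obtain ⟨h1, h2⟩ := setIntegral_monomialImage (d + 1 + s) g m n s
  have hvol : (0 : ℝ) < Real.pi ^ d / (d.factorial : ℝ) := by positivity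
  have hI : ballIntegrand (d + 1 + s) g m n = fun z =>
      ((a g)⁻¹ ^ (d + 1 + s) * mpow (p g) n)⁻¹
      * (monomialImage (d + 1 + s) g.1.1 n z * mpow (fun i => conj (z i)) m
        * ((1 - ∑ i, ‖z i‖ ^ 2 : ℝ) : ℂ) ^ s) := funext fun z => ballIntegrand_eq hg m n z
  refine ⟨?_, ?_⟩
  · rw [hI, ballMeasure]
    refine Integrable.smul_measure (h1.const_mul _) ?_
    rw [volume_unitBall]
    exact ENNReal.inv_ne_top.mpr (ENNReal.ofReal_pos.mpr hvol).ne'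
  · have hK : (a g)⁻¹ ^ (d + 1 + s) * mpow (p g) n ≠ 0 :=
      mul_ne_zero (pow_ne_zero _ (inv_ne_zero hg.1))
        (mpow_ne_zero (fun i => div_ne_zero (hg.2 i).1 hg.1) n)
    rw [hI, ballMeasure, integral_smul_measure, integral_const_mul, h2, volume_unitBall,
      ENNReal.toReal_inv, ENNReal.toReal_ofReal hvol.le, matCoeff_generic (by omega) hg,
      Complex.real_smul]
    have h3 := moment_normalization m s
    have hfac : ∀ k : ℕ, (k.factorial : ℂ) ≠ 0 := fun k => by exact_mod_cast k.factorial_ne_zero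
    have h4 := hfac (d + mdeg m + s)
    have h5 := hfac d
    have hpi : (Real.pi : ℂ) ≠ 0 := by exact_mod_cast Real.pi_ne_zero
    rw [mul_assoc ((a g)⁻¹ ^ _ * _), inv_mul_cancel_left₀ hK]
    push_cast at h3 h4 ⊢
    field_simp
    linear_combination (-(mpow (pt g) m * M (d + 1 + s) (U g) m n)) * h3

end BallIntegral

end MeixnerSU

end

open MeixnerSU in
theorem mainTheorem2 (d σ : ℕ) (hσ : d + 1 ≤ σ) :
    (∀ g : SU d, IsGeneric g →
      (∀ m m' : Fin d → ℕ,
        HasSum (fun n : Fin d → ℕ =>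
            poch σ (mdeg n) / (mfact n : ℂ) * mpow (p g) n * mpow (fun i => conj (p g i)) n
              * M σ (U g) m n * conj (M σ (U g) m' n))
          (if m = m' then
            (mfact m : ℂ) * (mpow (pt g) m)⁻¹ * (mpow (fun i => conj (pt g i)) m)⁻¹
              / (poch σ (mdeg m) * (p0sq g : ℂ) ^ σ)
          else 0)) ∧
      (∀ n n' : Fin d → ℕ,
        HasSum (fun m : Fin d → ℕ =>
            poch σ (mdeg m) / (mfact m : ℂ) * mpow (pt g) m * mpow (fun i => conj (pt g i)) m
              * M σ (U g) m n * conj (M σ (U g) m n'))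
          (if n = n' then
            (mfact n : ℂ) * (mpow (p g) n)⁻¹ * (mpow (fun i => conj (p g i)) n)⁻¹
              / (poch σ (mdeg n) * (p0sq g : ℂ) ^ σ)
          else 0)) ∧
      (∀ m n : Fin d → ℕ,
        Integrable (ballIntegrand σ g m n) (ballMeasure d) ∧
        (-1 : ℂ) ^ mdeg m * mpow (pt g) m * M σ (U g) m n
          = poch ((σ : ℂ) - (d : ℂ)) d / (d.factorial : ℂ)
            * ∫ z, ballIntegrand σ g m n z ∂(ballMeasure d)) ∧
      (∀ m n : Fin d → ℕ, M σ (U g) m n = M σ (U g)ᵀ n m)) ∧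
    (∀ g₁ g₂ : SU d, IsGeneric g₁ → IsGeneric g₂ → IsGeneric (g₁ * g₂) →
      ∀ m n : Fin d → ℕ,
        HasSum (fun k : Fin d → ℕ =>
            (-1 : ℂ) ^ mdeg k * mpow (p g₁) k * mpow (pt g₂) k
              * (poch σ (mdeg k) / (mfact k : ℂ)) * M σ (U g₁) m k * M σ (U g₂) k n)
          ((a g₁ * a g₂ / a (g₁ * g₂)) ^ σ
            * mpow (pt (g₁ * g₂)) m * (mpow (pt g₁) m)⁻¹
            * mpow (p (g₁ * g₂)) n * (mpow (p g₂) n)⁻¹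
            * M σ (U (g₁ * g₂)) m n)) := by
  obtain ⟨s, rfl⟩ := Nat.exists_eq_add_of_le hσ
  have hσ0 : 0 < d + 1 + s := by omega
  exact ⟨fun g hg => ⟨hasSum_meixner_orthogonal hσ0 hg, hasSum_meixner_dual_orthogonal hσ0 hg,
    meixner_eq_integral hg, meixner_transpose hσ0 (U g)⟩,
    fun g₁ g₂ h₁ h₂ h₁₂ => hasSum_meixner_mul hσ0 h₁ h₂ h₁₂⟩
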